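/- Write points of $\mathbb R^3$ as $x=(x_0,x_1,x_2)$. Let $\mu,\tilde\mu\in[0,1)\cup i\mathbb R^+$ and let $\Omega_\mu=\{x: x_0^2+(x_1^2+x_2^2)/(1-\mu^2)<1\}$. Write $(a)_n=a(a+1)\cdots(a+n-1)$, $\Phi_m^+(\phi)=\cos m\phi$, $\Phi_m^-(\phi)=\sin m\phi$, where the sign $-$ is used for $m\ge1$ only. **Harmonics.** For $\mu\ne0$, in the coordinates $x_0=\mu\cos u\cosh v$, $x_1=\mu\sin u\sinh v\cos\phi$, $x_2=\mu\sin u\sinh v\sin\phi$, put $$U^{\pm}_{n,m}[\mu](x)=\frac{(n-m)!}{2^n(1/2)_n}\,\mu^nP_n^m(\cos u)\,P_n^m(\cosh v)\,\Phi_m^{\pm}(\phi),\qquad U^{\pm}_{n,m}[0](x)=|x|^nP_n^m(x_0/|x|)\,\Phi_m^{\pm}(\phi),$$ where $P_n^m$ are the associated Legendre functions, $P_n^m(\cos u)=(-1)^m\sin^m u\,P_n^{(m)}(\cos u)$, $P_n^m(\cosh v)=\sinh^m v\,P_n^{(m)}(\cosh v)$, and $U^\pm_{n,m}[\mu]=0$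 for $m>n$. These are real polynomials in $x$. Let $V^{\pm}_{n,m}[\mu]=\partial U^{\pm}_{n+1,m}[\mu]/\partial x_0$. **Ambigenics and contragenics.** With the quaternion units $e_1,e_2,e_3=e_1e_2$, let $X^{\pm}_{n,m}[\mu]=(\partial_{x_0}-e_1\partial_{x_1}-e_2\partial_{x_2})U^{\pm}_{n+1,m}[\mu]$ and $A^{\pm}_{n,m}[\mu]=2\,\mathrm{Vec}\,X^{\pm}_{n,m}[\mu]$. Let $\nu_{n,0}[\mu]=1$, $\nu_{n,m}[\mu]=0$ for $m\ge n$, $m\ge 1$, and for $1\le m\le n-1$ $$\nu_{n,m}[\mu]=\kappa_m\Bigl(\frac{1}{(n+m+1)_2}\,\frac{\|V^+_{n,m+1}[\mu]\|_{L^2(\Omega_\mu)}}{\|V^+_{n,m-1}[\mu]\|_{L^2(\Omega_\mu)}}\Bigr)^2,$$ where $\kappa_m=1$ for $m\ge2$ and $\kappa_1\in\{1,2\}$ is fixed (the statement holds for both normalizations; $\kappa_1=2$ is the one for which the functions $Z^\pm_{n,1}$ are orthogonal to the ambigenics). Let $Z^+_{n,0}[\mu]=-A^+_{n,0}[\mu]e_3$,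 and for $m\ge1$ $$Z^{\pm}_{n,m}[\mu]=\tfrac12\bigl(\mp(\nu_{n,m}[\mu]+1)\,A^{\pm}_{n,m}[\mu]\,e_3+(\nu_{n,m}[\mu]-1)\,A^{\mp}_{n,m}[\mu]\bigr)$$ (these are $0$ for $m\ge n$). **Coefficients.** For $\mu\neq0$ and $0\le2k\le n-m+2$ let $$w_{n,m,k}[\tilde\mu,\mu]={}_2F_1\bigl(-k,-n+k-\tfrac32;-n-\tfrac12;(\tilde\mu/\mu)^2\bigr)\,\frac{(n+m+1)!\,(1/2)_{n-2k+2}}{4^kk!\,(n+m-2k+1)!\,(1/2)_{n-k+2}}\,\mu^{2k},$$ and for $\mu=0$ and $0\le 2k\le n+1$, $m\le n+1$, let $$w_{n,m,k}[\tilde\mu,0]=\frac{(1/2)_{n-k+1}(n+m-2k+2)_{2k}}{(-4)^k(1/2)_{n+1}\,k!}\,\tilde\mu^{2k}$$ (the limit as $\mu\to0$ in the range of indices used below). Put $z^C_{n,0,k}=\frac{n-2k+2}{n+2}\,w_{n,1,k}[\tilde\mu,\mu]$, and for $m\ge1$, with $\nu_k:=\nu_{n-2k,m}[\mu]$, $\tilde\nu:=\nu_{n,m}[\tilde\mu]$,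 $w_k:=w_{n,m,k}[\tilde\mu,\mu]$, $$z^C_{n,m,k}=\frac{\tilde\nu+1}{\nu_k+1}w_k,\quad z^A_{n,m,k}=\frac{\tilde\nu-\nu_k}{\nu_k+1}w_k\qquad(0\le2k\le n-m-1),$$ $$z^C_{n,m,k}=z^A_{n,m,k}=\frac{\tilde\nu}{\nu_k+1}w_k\qquad(n-m\le2k\le n-m+1).$$ **Proposition.** Let $n\ge1$. Then $$Z^+_{n,0}[\tilde\mu]=\sum_{0\le2k\le n-1}z^C_{n,0,k}\,Z^+_{n-2k,0}[\mu],$$ and for $1\le m\le n-1$ and both choices of the sign, $$Z^{\pm}_{n,m}[\tilde\mu]=\sum_{0\le2k\le n-m+1}\bigl(z^C_{n,m,k}\,Z^{\pm}_{n-2k,m}[\mu]+z^A_{n,m,k}\,A^{\mp}_{n-2k,m}[\mu]\bigr).$$ -/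

import Mathlib

open scoped Quaternion

noncomputable section

namespace Spheroidal

/-- Points `x = (x 0, x 1, x 2)` of three-dimensional Euclidean space. -/
abbrev E3 := EuclideanSpace ℝ (Fin 3)

/-- The admissible parameters `μ ∈ [0,1) ∪ iℝ⁺`, that is, the values of `(1 - e^(2ν))^(1/2)`
for real `ν`. -/
def params : Set ℂ :=
  {μ | (μ.im = 0 ∧ 0 ≤ μ.re ∧ μ.re < 1) ∨ (μ.re = 0 ∧ 0 < μ.im)}

/-- The spheroid `Ω_μ`; here `1 - μ ^ 2 = e^(2ν)` is a positive real number. -/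
def spheroid (μ : ℂ) : Set E3 :=
  {x | x 0 ^ 2 + (x 1 ^ 2 + x 2 ^ 2) / (1 - μ ^ 2).re < 1}

/-- The rising factorial `(a)_n = a (a + 1) ⋯ (a + n - 1)`. -/
def poch (a : ℝ) (n : ℕ) : ℝ := (ascPochhammer ℝ n).eval a

/-- The Legendre polynomial `P_n`, by the formula of Rodrigues. -/
def legendre (n : ℕ) : Polynomial ℝ :=
  Polynomial.C (1 / (2 ^ n * (n.factorial : ℝ))) *
    Polynomial.derivative^[n] ((Polynomial.X ^ 2 - 1) ^ n)

/-- The polynomial `d^m P_n / dt^m`. -/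
def legendreDeriv (n m : ℕ) : Polynomial ℝ := Polynomial.derivative^[m] (legendre n)

/-- The associated Legendre function `P_n^m(t) = (-1)^m (1 - t^2)^(m/2) P_n^(m)(t)` on the cut
`-1 ≤ t ≤ 1`. -/
def assocLegendre (n m : ℕ) (t : ℝ) : ℝ :=
  (-1) ^ m * Real.sqrt (1 - t ^ 2) ^ m * (legendreDeriv n m).eval t

/-- The same function at `t = cos u`, where `(1 - t^2)^(1/2) = sin u`. -/
def assocLegendreCos (n m : ℕ) (u : ℂ) : ℂ :=
  (-1) ^ m * Complex.sin u ^ m * Polynomial.aeval (Complex.cos u) (legendreDeriv n m)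

/-- The associated Legendre function `P_n^m(z) = (z^2 - 1)^(m/2) P_n^(m)(z)` off the cut, at
`z = cosh v`, where `(z^2 - 1)^(1/2) = sinh v`. -/
def assocLegendreCosh (n m : ℕ) (v : ℂ) : ℂ :=
  Complex.sinh v ^ m * Polynomial.aeval (Complex.cosh v) (legendreDeriv n m)

/-- The angular factors `Φ_m^+(φ) = cos (m φ)` and `Φ_m^-(φ) = sin (m φ)`.  The signs `±` are the
elements `1` and `-1` of `ℤˣ`, so that `∓` is `-ε` when `±` is `ε`. -/
def ang (ε : ℤˣ) (m : ℕ) (φ : ℝ) : ℝ :=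
  if ε = 1 then Real.cos (m * φ) else Real.sin (m * φ)

/-- `(u, v, φ)` are spheroidal coordinates of the point `x`, for the parameter `μ`.  Complex `u`
and `v` are allowed: on a prolate spheroid one may take `u ∈ [0, π]` and `v ≥ 0` real, on an
oblate one `u ∈ [0, π]` and `v = w - iπ/2` with `w ≥ 0`. -/
def IsCoords (μ : ℂ) (x : E3) (u v : ℂ) (φ : ℝ) : Prop :=
  (x 0 : ℂ) = μ * Complex.cos u * Complex.cosh v ∧
  (x 1 : ℂ) = μ * Complex.sin u * Complex.sinh v * (Real.cos φ : ℂ) ∧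
  (x 2 : ℂ) = μ * Complex.sin u * Complex.sinh v * (Real.sin φ : ℂ)

/-- The solid spheroidal harmonic of parameter `μ ≠ 0` in spheroidal coordinates. -/
def solidCoords (n m : ℕ) (ε : ℤˣ) (μ u v : ℂ) (φ : ℝ) : ℂ :=
  (((n - m).factorial : ℝ) / (2 ^ n * poch (1 / 2) n) : ℝ) * μ ^ n *
    assocLegendreCos n m u * assocLegendreCosh n m v * (ang ε m φ : ℂ)

/-- Every point has spheroidal coordinates. -/
theorem exists_coords {μ : ℂ} (hμ : μ ≠ 0) (x : E3) :
    ∃ p : ℂ × ℂ × ℝ, IsCoords μ x p.1 p.2.1 p.2.2 := by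
  set z : ℂ := ⟨x 1, x 2⟩ with hz
  have h1 : x 1 = ‖z‖ * Real.cos z.arg := (Complex.norm_mul_cos_arg z).symm
  have h2 : x 2 = ‖z‖ * Real.sin z.arg := (Complex.norm_mul_sin_arg z).symm
  obtain ⟨a, ha⟩ := Complex.cos_surjective ((x 0 - Complex.I * ‖z‖) / μ)
  obtain ⟨b, hb⟩ := Complex.cos_surjective ((x 0 + Complex.I * ‖z‖) / μ)
  have hI := Complex.I_mul_I
  -- with `u + i v = a` and `u - i v = b`
  have ea : a = (a + b) / 2 + (-(Complex.I * (a - b) / 2)) * Complex.I := by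
    linear_combination ((a - b) / 2) * hI
  have eb : b = (a + b) / 2 - (-(Complex.I * (a - b) / 2)) * Complex.I := by
    linear_combination (-(a - b) / 2) * hI
  generalize (a + b) / 2 = u at ea eb
  generalize -(Complex.I * (a - b) / 2) = v at ea eb
  have ca : Complex.cos u * Complex.cosh v - Complex.sin u * Complex.sinh v * Complex.I
      = (x 0 - Complex.I * ‖z‖) / μ := by
    rw [← ha, ea, Complex.cos_add, Complex.cos_mul_I, Complex.sin_mul_I]; ring
  have cb : Complex.cos u * Complex.cosh v + Complex.sin u * Complex.sinh v * Complex.I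
      = (x 0 + Complex.I * ‖z‖) / μ := by
    rw [← hb, eb, Complex.cos_sub, Complex.cos_mul_I, Complex.sin_mul_I]; ring
  rw [eq_div_iff hμ] at ca cb
  have hs : μ * Complex.sin u * Complex.sinh v = ‖z‖ := by
    linear_combination (Complex.I / 2) * (ca - cb) +
      (μ * Complex.sin u * Complex.sinh v - ‖z‖) * hI
  refine ⟨(u, v, z.arg), ?_, ?_, ?_⟩
  · simp only
    linear_combination -(ca + cb) / 2
  · simp only
    rw [hs, h1]; push_cast; rfl
  · simp only
    rw [hs, h2]; push_cast; rfl

/-- The derivatives of Legendre polynomials are even or odd. -/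
theorem legendreDeriv_neg (n m : ℕ) :
    ∃ c : ℂ, c * c = 1 ∧ ∀ z : ℂ, Polynomial.aeval (-z) (legendreDeriv n m) =
      c * Polynomial.aeval z (legendreDeriv n m) := by
  have key : ∀ (k : ℕ) (p : Polynomial ℝ), p.comp (-Polynomial.X) = p →
      (Polynomial.derivative^[k] p).comp (-Polynomial.X) =
        (-1) ^ k * Polynomial.derivative^[k] p := by
    intro k p hp
    induction k with
    | zero => simpa using hp
    | succ k ih =>
      have h := congrArg Polynomial.derivative ih
      have hd : Polynomial.derivative ((-1 : Polynomial ℝ) ^ k) = 0 := by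
        rw [show (-1 : Polynomial ℝ) = Polynomial.C (-1) by simp, ← Polynomial.C_pow,
          Polynomial.derivative_C]
      rw [Polynomial.derivative_comp, Polynomial.derivative_mul, hd] at h
      simp only [Polynomial.derivative_neg, Polynomial.derivative_X] at h
      rw [Function.iterate_succ_apply', pow_succ]
      linear_combination -h
  have h : (legendreDeriv n m).comp (-Polynomial.X) = (-1) ^ (m + n) * legendreDeriv n m := by
    have e : legendreDeriv n m = Polynomial.C (1 / (2 ^ n * (n.factorial : ℝ))) *
        Polynomial.derivative^[m + n] ((Polynomial.X ^ 2 - 1) ^ n) := by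
      rw [legendreDeriv, legendre, Polynomial.iterate_derivative_C_mul,
        Function.iterate_add_apply]
    rw [e, Polynomial.mul_comp, Polynomial.C_comp, key _ _ (by simp)]
    ring
  refine ⟨(-1) ^ (m + n), by rw [← mul_pow]; simp, fun z => ?_⟩
  have := congrArg (Polynomial.aeval z) h
  simpa [Polynomial.aeval_comp] using this

/-- The value of a solid spheroidal harmonic at a point does not depend on the choice of the
spheroidal coordinates of that point. -/
theorem solidCoords_eq {μ : ℂ} (hμ : μ ≠ 0) {x : E3} {u v u' v' : ℂ} {φ φ' : ℝ}
    (h : IsCoords μ x u v φ) (h' : IsCoords μ x u' v' φ') (n m : ℕ) (ε : ℤˣ) :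
    solidCoords n m ε μ u v φ = solidCoords n m ε μ u' v' φ' := by
  -- the angular part is a function of `x`
  have angle : ∀ {u v : ℂ} {φ : ℝ}, IsCoords μ x u v φ →
      (μ * Complex.sin u * Complex.sinh v) ^ m * (ang ε m φ : ℂ) =
        if ε = 1 then ((x 1 + x 2 * Complex.I) ^ m + (x 1 - x 2 * Complex.I) ^ m) / 2
        else ((x 1 - x 2 * Complex.I) ^ m - (x 1 + x 2 * Complex.I) ^ m) * Complex.I / 2 := by
    rintro u v φ ⟨-, h1, h2⟩
    have e1 : (x 1 + x 2 * Complex.I : ℂ) =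
        μ * Complex.sin u * Complex.sinh v * Complex.exp (φ * Complex.I) := by
      rw [h1, h2, Complex.exp_mul_I]; push_cast; ring
    have e2 : (x 1 - x 2 * Complex.I : ℂ) =
        μ * Complex.sin u * Complex.sinh v * Complex.exp (-φ * Complex.I) := by
      rw [h1, h2, Complex.exp_mul_I, Complex.cos_neg, Complex.sin_neg]; push_cast; ring
    rw [e1, e2, mul_pow _ (Complex.exp _), mul_pow _ (Complex.exp _), ← Complex.exp_nat_mul,
      ← Complex.exp_nat_mul]
    generalize μ * Complex.sin u * Complex.sinh v = s
    unfold ang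
    split_ifs with hε
    · push_cast
      rw [Complex.cos, show (m : ℂ) * (φ * Complex.I) = m * φ * Complex.I by ring,
        show (m : ℂ) * (-φ * Complex.I) = -(m * φ) * Complex.I by ring]
      ring
    · push_cast
      rw [Complex.sin, show (m : ℂ) * (φ * Complex.I) = m * φ * Complex.I by ring,
        show (m : ℂ) * (-φ * Complex.I) = -(m * φ) * Complex.I by ring]
      ring
  -- the product of the values of two even or odd functions is symmetric
  have radial : Polynomial.aeval (Complex.cos u) (legendreDeriv n m) *
        Polynomial.aeval (Complex.cosh v) (legendreDeriv n m) =
      Polynomial.aeval (Complex.cos u') (legendreDeriv n m) *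
        Polynomial.aeval (Complex.cosh v') (legendreDeriv n m) := by
    have sq : ∀ {u v : ℂ} {φ : ℝ}, IsCoords μ x u v φ →
        μ ^ 2 * (Complex.cos u ^ 2 + Complex.cosh v ^ 2) =
          μ ^ 2 + x 0 ^ 2 + x 1 ^ 2 + x 2 ^ 2 := by
      rintro u v φ ⟨h0, h1, h2⟩
      have a1 := Complex.sin_sq_add_cos_sq u
      have a2 := Complex.cosh_sq v
      have a3 : ((Real.sin φ : ℂ)) ^ 2 + (Real.cos φ : ℂ) ^ 2 = 1 := by
        exact_mod_cast Real.sin_sq_add_cos_sq φ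
      have s1 : Complex.sin u ^ 2 = 1 - Complex.cos u ^ 2 := by linear_combination a1
      have s2 : Complex.sinh v ^ 2 = Complex.cosh v ^ 2 - 1 := by linear_combination -a2
      have a4 : (x 1 : ℂ) ^ 2 + x 2 ^ 2 =
          μ ^ 2 * ((1 - Complex.cos u ^ 2) * (Complex.cosh v ^ 2 - 1)) := by
        rw [h1, h2, ← s1, ← s2]
        linear_combination (μ ^ 2 * Complex.sin u ^ 2 * Complex.sinh v ^ 2) * a3
      rw [add_assoc, a4, h0]; ring
    have hs : Complex.cos u ^ 2 + Complex.cosh v ^ 2 =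
        Complex.cos u' ^ 2 + Complex.cosh v' ^ 2 :=
      mul_left_cancel₀ (pow_ne_zero 2 hμ) ((sq h).trans (sq h').symm)
    have hp : Complex.cos u * Complex.cosh v = Complex.cos u' * Complex.cosh v' := by
      have := h.1.symm.trans h'.1
      rw [mul_assoc, mul_assoc] at this
      exact mul_left_cancel₀ hμ this
    obtain ⟨c, hc, hneg⟩ := legendreDeriv_neg n m
    generalize Complex.cos u = p at *
    generalize Complex.cosh v = q at *
    generalize Complex.cos u' = p' at *
    generalize Complex.cosh v' = q' at *
    have f : (p - p') * (p + p') * ((p - q') * (p + q')) = 0 := by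
      linear_combination p ^ 2 * hs - (p * q + p' * q') * hp
    have pm : (p = p' ∨ p = -p') ∨ (p = q' ∨ p = -q') := by
      rcases mul_eq_zero.1 f with f | f <;> rcases mul_eq_zero.1 f with f | f
      · exact .inl (.inl (sub_eq_zero.1 f))
      · exact .inl (.inr (eq_neg_of_add_eq_zero_left f))
      · exact .inr (.inl (sub_eq_zero.1 f))
      · exact .inr (.inr (eq_neg_of_add_eq_zero_left f))
    -- once `p` is matched, so is `q`, up to the same sign
    have fin : ∀ {q r s : ℂ}, r ^ 2 + q ^ 2 = r ^ 2 + s ^ 2 → r * q = r * s →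
        Polynomial.aeval r (legendreDeriv n m) * Polynomial.aeval q (legendreDeriv n m) =
        Polynomial.aeval r (legendreDeriv n m) * Polynomial.aeval s (legendreDeriv n m) := by
      intro q r s h1 h2
      rcases eq_or_ne r 0 with rfl | hr
      · have : q ^ 2 = s ^ 2 := by linear_combination h1
        rcases sq_eq_sq_iff_eq_or_eq_neg.1 this with rfl | rfl
        · rfl
        · have e := hneg 0
          rw [neg_zero] at e
          rw [hneg s]
          linear_combination -Polynomial.aeval s (legendreDeriv n m) * e
      · rw [mul_left_cancel₀ hr h2]
    rcases pm with (rfl | rfl) | (rfl | rfl)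
    · exact fin hs hp
    · have := @fin q (-p') (-q') (by linear_combination hs) (by linear_combination hp)
      rw [this, hneg, hneg]
      linear_combination (Polynomial.aeval p' (legendreDeriv n m) *
        Polynomial.aeval q' (legendreDeriv n m)) * hc
    · rw [fin (s := p') (by linear_combination hs) (by linear_combination hp), mul_comm]
    · have := @fin q (-q') (-p') (by linear_combination hs) (by linear_combination hp)
      rw [this, hneg, hneg]
      linear_combination (Polynomial.aeval p' (legendreDeriv n m) *
        Polynomial.aeval q' (legendreDeriv n m)) * hc
  have hA := (angle h).trans (angle h').symm
  rw [mul_assoc μ, mul_assoc μ, mul_pow μ, mul_pow μ, mul_assoc (μ ^ m), mul_assoc (μ ^ m)] at hA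
  have hA := mul_left_cancel₀ (pow_ne_zero m hμ) hA
  rw [mul_pow, mul_pow] at hA
  unfold solidCoords assocLegendreCos assocLegendreCosh
  generalize ((((n - m).factorial : ℝ) / (2 ^ n * poch (1 / 2) n) : ℝ) : ℂ) = K
  linear_combination (K * μ ^ n * (-1) ^ m * Polynomial.aeval (Complex.cos u) (legendreDeriv n m) *
    Polynomial.aeval (Complex.cosh v) (legendreDeriv n m)) * hA +
    (K * μ ^ n * (-1) ^ m * (Complex.sin u' ^ m * Complex.sinh v' ^ m * (ang ε m φ' : ℂ))) * radial

open Classical in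
/-- The solid spheroidal harmonics `U^±_{n,m}[μ]`; for `μ = 0` these are the classical solid
spherical harmonics `|x|^n P_n^m(x₀ / |x|) Φ_m^±(φ)`.  The value computed in spheroidal
coordinates is a real number, and does not depend on the coordinates chosen. -/
def solid (n m : ℕ) (ε : ℤˣ) (μ : ℂ) (x : E3) : ℝ :=
  if hμ : μ = 0 then
    ‖x‖ ^ n * assocLegendre n m (x 0 / ‖x‖) * ang ε m (Complex.arg ⟨x 1, x 2⟩)
  else
    (solidCoords n m ε μ (exists_coords hμ x).choose.1 (exists_coords hμ x).choose.2.1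
      (exists_coords hμ x).choose.2.2).re

/-- The partial derivative `∂f/∂x_i`. -/
def pderiv (i : Fin 3) (f : E3 → ℝ) (x : E3) : ℝ := fderiv ℝ f x (EuclideanSpace.single i 1)

/-- The Garabedian spheroidal harmonics `V^±_{n,m}[μ] = ∂U^±_{n+1,m}[μ]/∂x₀`. -/
def garabedian (n m : ℕ) (ε : ℤˣ) (μ : ℂ) (x : E3) : ℝ := pderiv 0 (solid (n + 1) m ε μ) x

/-- The norm of `L²(Ω_μ)`. -/
def l2Norm (μ : ℂ) (f : E3 → ℝ) : ℝ :=
  Real.sqrt (∫ x in spheroid μ, f x ^ 2)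

/-- The norm ratios.  The factor `κ` enters for `m = 1` only, and `κ = 1` is the uniform formula
`((‖V^+_{n,m+1}‖ / ‖V^+_{n,m-1}‖) / (n+m+1)_2)^2`.  Because `cos² (mφ)` has mean `1` for `m = 0`
and `1/2` for `m ≥ 1`, it is the value `κ = 2` that makes the functions `contra κ n 1 ε μ` below
orthogonal to the ambigenics. -/
def normRatio (κ : ℝ) (n m : ℕ) (μ : ℂ) : ℝ :=
  if m = 0 then 1
  else if m < n then
    (if m = 1 then κ else 1) *
      (1 / poch ((n : ℝ) + m + 1) 2 *
        (l2Norm μ (garabedian n (m + 1) 1 μ) / l2Norm μ (garabedian n (m - 1) 1 μ))) ^ 2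
  else 0

/-- The basic monogenic polynomials
`X^±_{n,m}[μ] = (∂/∂x₀ - e₁ ∂/∂x₁ - e₂ ∂/∂x₂) U^±_{n+1,m}[μ]`. -/
def monogenic (n m : ℕ) (ε : ℤˣ) (μ : ℂ) (x : E3) : ℍ[ℝ] :=
  ⟨pderiv 0 (solid (n + 1) m ε μ) x, -pderiv 1 (solid (n + 1) m ε μ) x,
    -pderiv 2 (solid (n + 1) m ε μ) x, 0⟩

/-- The ambigenics `A^±_{n,m}[μ] = 2 Vec X^±_{n,m}[μ]`. -/
def ambi (n m : ℕ) (ε : ℤˣ) (μ : ℂ) (x : E3) : ℍ[ℝ] := (2 : ℝ) • (monogenic n m ε μ x).im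

/-- The quaternion unit `e₃ = e₁ e₂`. -/
def e₃ : ℍ[ℝ] := ⟨0, 0, 0, 1⟩

/-- The basic contragenics `Z^+_{n,0}[μ] = - A^+_{n,0}[μ] e₃` and, for `m ≥ 1`,
`Z^±_{n,m}[μ] = ((ν - 1) A^∓_{n,m}[μ] ∓ (ν + 1) A^±_{n,m}[μ] e₃) / 2`, where `ν` is the norm
ratio. -/
def contra (κ : ℝ) (n m : ℕ) (ε : ℤˣ) (μ : ℂ) (x : E3) : ℍ[ℝ] :=
  if m = 0 then -(ambi n 0 1 μ x * e₃)
  else (1 / 2 : ℝ) • ((normRatio κ n m μ - 1) • ambi n m (-ε) μ x -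
    (((ε : ℤ) : ℝ) * (normRatio κ n m μ + 1)) • (ambi n m ε μ x * e₃))

/-- The rational constants
`(1/2)_{n-k} (n+m-2k+1)_{2k} / ((-4)^k (1/2)_n k!)`, which convert `U_{n,m}[μ]` into the functions
`μ^(2k) U_{n-2k,m}[0]`. -/
def uCoeff (n m k : ℕ) : ℝ :=
  if m ≤ n ∧ 2 * k ≤ n then
    poch (1 / 2) (n - k) * poch ((n : ℝ) + m - 2 * k + 1) (2 * k) /
      ((-4) ^ k * poch (1 / 2) n * (k.factorial : ℝ))
  else 0

/-- The constants `(n+m+1)! (1/2)_{n-2k+2} / (4^k k! (n+m-2k+1)! (1/2)_{n-k+2})`. -/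
def wConst (n m k : ℕ) : ℝ :=
  if 2 * k + m ≤ n + 2 then
    ((n + m + 1).factorial : ℝ) * poch (1 / 2) (n + 2 - 2 * k) /
      (4 ^ k * (k.factorial : ℝ) * ((n + m + 1 - 2 * k).factorial : ℝ) *
        poch (1 / 2) (n + 2 - k))
  else 0

/-- The conversion coefficients `w_{n,m,k}[μ̃, μ]` among Garabedian harmonics, with their limits
as `μ → 0` in the case `μ = 0`.  The squares of `μ` and `μ̃` are real numbers. -/
def w (n m k : ℕ) (μt μ : ℂ) : ℝ :=
  if μ = 0 then uCoeff (n + 1) m k * (μt ^ (2 * k)).re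
  else ₂F₁ (-(k : ℝ)) (-(n : ℝ) + k - 3 / 2) (-(n : ℝ) - 1 / 2) (((μt / μ) ^ 2).re) *
    wConst n m k * (μ ^ (2 * k)).re

/-- The coefficients of the contragenics in the expansion of `Z_{n,m}[μ̃]`. -/
def zC (κ : ℝ) (n m k : ℕ) (μt μ : ℂ) : ℝ :=
  if m = 0 then ((n : ℝ) - 2 * k + 2) / (n + 2) * w n 1 k μt μ
  else if 2 * k + m + 1 ≤ n then
    (normRatio κ n m μt + 1) / (normRatio κ (n - 2 * k) m μ + 1) * w n m k μt μ
  else normRatio κ n m μt / (normRatio κ (n - 2 * k) m μ + 1) * w n m k μt μ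

/-- The coefficients of the ambigenics in the expansion of `Z_{n,m}[μ̃]`, for `m ≥ 1`. -/
def zA (κ : ℝ) (n m k : ℕ) (μt μ : ℂ) : ℝ :=
  if 2 * k + m + 1 ≤ n then
    (normRatio κ n m μt - normRatio κ (n - 2 * k) m μ) / (normRatio κ (n - 2 * k) m μ + 1) *
      w n m k μt μ
  else normRatio κ n m μt / (normRatio κ (n - 2 * k) m μ + 1) * w n m k μt μ

end Spheroidal

end

noncomputable section

namespace Spheroidal

/-! Everything reduces to a conversion formula for the harmonics $U_{n,m}$. In spheroidal
coordinates, with $s=\cos u$ and $t=\cosh v$, one has $x_0=\mu st$ and $|x|^2=\mu^2(s^2+t^2-1)$.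
Both $P_n^{(m)}(s)P_n^{(m)}(t)$ and the zonal factors of spherical harmonics, as polynomials in $st$
and $s^2+t^2-1$, are killed by the difference of the Gegenbauer operators in $s$ and $t$. A
polynomial in that kernel is determined by its restriction to $s=1$
(`eq_zero_of_gegenbauerDiff_eq_zero`), where the comparison is one of powers of $t$. This gives
`legendreDeriv_mul_legendreDeriv`, and from it $U[\mu]$ as a combination of the
$\mu^{2k}U_{n-2k,m}[0]$ (`solid_eq_sum_solid_zero`).

To pass from $\tilde\mu$ to $\mu$, both sides are expanded in spherical harmonics. The coefficients
agree by the summation `sum_ordinaryHypergeometric_mul_wConst_mul_uCoeff`, which rests on a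
telescoping sum, and `solid_eq_sum_solid` follows.

Differentiation carries the same coefficients $w_{n,m,k}$ over to the ambigenics. Since $Z^\pm$ is a
combination of $A^\mp$ and $A^\pm e_3$, it remains to compare the coefficients of these two. In
degrees $m$ and $m-1$ the contragenic vanishes, and the Cauchy-Riemann equations
(`ambi_mul_e₃_of_le`) turn $A^\pm e_3$ into a multiple of $A^\mp$. For $m\ge1$ the norm ratios enter
only through two facts: they are nonnegative, and they vanish in degrees up to $m$. -/

/-! ### Pochhammer symbols -/

theorem poch_zero (a : ℝ) : poch a 0 = 1 := by simp [poch]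

theorem poch_succ (a : ℝ) (n : ℕ) : poch a (n + 1) = poch a n * (a + n) := by
  simp [poch, ascPochhammer_succ_eval]

theorem poch_one (a : ℝ) : poch a 1 = a := by simp [poch]

theorem poch_add (a : ℝ) (n k : ℕ) : poch a (n + k) = poch a n * poch (a + n) k := by
  induction k with
  | zero => simp [poch_zero]
  | succ k ih =>
    rw [← add_assoc, poch_succ, ih, poch_succ]
    push_cast
    ring

theorem poch_ne_zero {a : ℝ} {n : ℕ} (h : ∀ i < n, a + i ≠ 0) : poch a n ≠ 0 := by
  induction n with
  | zero => simp [poch_zero]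
  | succ n ih =>
    rw [poch_succ]
    exact mul_ne_zero (ih fun i hi => h i (by omega)) (h n (by omega))

theorem poch_reflect (a : ℝ) (n : ℕ) : poch a n = (-1) ^ n * poch (1 - a - n) n := by
  induction n with
  | zero => simp [poch_zero]
  | succ n ih =>
    rw [poch_succ, ih, add_comm n 1, poch_add, poch_one, add_comm 1 n,
      show 1 - a - ((n + 1 : ℕ) : ℝ) + (1 : ℕ) = 1 - a - n by push_cast; ring]
    push_cast
    ring

theorem poch_half_ne_zero (n : ℕ) : poch (1 / 2) n ≠ 0 :=
  poch_ne_zero fun i _ => by positivity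

theorem poch_natCast_add_one (n k : ℕ) :
    poch ((n : ℝ) + 1) k * (n.factorial : ℝ) = ((n + k).factorial : ℝ) := by
  induction k with
  | zero => simp [poch_zero]
  | succ k ih =>
    rw [poch_succ, ← add_assoc, Nat.factorial_succ]
    push_cast
    rw [← ih]
    ring

theorem poch_half_mul (n : ℕ) :
    poch (1 / 2) n * (4 ^ n * (n.factorial : ℝ)) = ((2 * n).factorial : ℝ) := by
  induction n with
  | zero => simp [poch_zero]
  | succ n ih =>
    rw [show 2 * (n + 1) = 2 * n + 1 + 1 by ring, Nat.factorial_succ (2 * n + 1),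
      Nat.factorial_succ (2 * n), Nat.factorial_succ n, poch_succ]
    push_cast
    rw [← ih]
    ring

/-! ### Derivatives of Legendre polynomials -/

/-- The coefficient of `X ^ (n - m - 2 i)` in the `m`-th derivative of the `n`-th Legendre
polynomial. -/
def legendreCoeff (n m i : ℕ) : ℝ :=
  (-1) ^ i * (n.choose i : ℝ) * ((2 * n - 2 * i).factorial : ℝ) /
    (2 ^ n * (n.factorial : ℝ) * ((n - m - 2 * i).factorial : ℝ))

theorem legendreDeriv_eq_iterate (n m : ℕ) :
    legendreDeriv n m = Polynomial.C (1 / (2 ^ n * (n.factorial : ℝ))) *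
        Polynomial.derivative^[n + m] ((Polynomial.X ^ 2 - 1) ^ n) := by
  rw [legendreDeriv, legendre, Polynomial.iterate_derivative_C_mul, add_comm n m,
    Function.iterate_add_apply]

theorem legendreDeriv_succ (n m : ℕ) :
    legendreDeriv n (m + 1) = Polynomial.derivative (legendreDeriv n m) := by
  rw [legendreDeriv, legendreDeriv, Function.iterate_succ_apply']

theorem legendreDeriv_eq_zero {n m : ℕ} (h : n < m) : legendreDeriv n m = 0 := by
  rw [legendreDeriv_eq_iterate, Polynomial.iterate_derivative_eq_zero, mul_zero]
  have h1 : ((Polynomial.X ^ 2 - 1 : Polynomial ℝ) ^ n).natDegree ≤ n * 2 := by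
    refine Polynomial.natDegree_pow_le_of_le n ?_
    compute_degree
  omega

theorem legendreDeriv_eq_sum {n m : ℕ} (h : m ≤ n) :
    legendreDeriv n m = ∑ i ∈ Finset.range ((n - m) / 2 + 1),
      Polynomial.C (legendreCoeff n m i) * Polynomial.X ^ (n - m - 2 * i) := by
  rw [legendreDeriv_eq_iterate, sub_eq_neg_add, add_pow, Polynomial.iterate_derivative_sum,
    Finset.mul_sum]
  have term : ∀ i, i ≤ n → Polynomial.C (1 / (2 ^ n * (n.factorial : ℝ))) *
      Polynomial.derivative^[n + m] ((-1 : Polynomial ℝ) ^ i *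
        (Polynomial.X ^ 2) ^ (n - i) * (n.choose i : Polynomial ℝ)) =
      Polynomial.C (1 / (2 ^ n * (n.factorial : ℝ)) * ((-1) ^ i * (n.choose i : ℝ)) *
        ((2 * n - 2 * i).descFactorial (n + m) : ℝ)) *
        Polynomial.X ^ (2 * n - 2 * i - (n + m)) := by
    intro i hi
    have e : (-1 : Polynomial ℝ) ^ i * (Polynomial.X ^ 2) ^ (n - i) *
        (n.choose i : Polynomial ℝ) =
        Polynomial.C ((-1) ^ i * (n.choose i : ℝ)) * Polynomial.X ^ (2 * n - 2 * i) := by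
      rw [← pow_mul, show 2 * (n - i) = 2 * n - 2 * i by omega]
      simp only [map_mul, map_pow, map_neg, map_one, map_natCast]
      ring
    rw [e, Polynomial.iterate_derivative_C_mul,
      Polynomial.iterate_derivative_X_pow_eq_C_mul]
    simp only [map_mul]
    ring
  rw [Finset.sum_congr rfl fun i hi => term i (Nat.lt_succ_iff.1 (Finset.mem_range.1 hi))]
  symm
  -- The binomial terms with $2i>n-m$ have degree below $n+m$ and are killed by the derivative.
  refine Finset.sum_subset_zero_on_sdiff (fun i hi => ?_) (fun i hi => ?_) (fun i hi => ?_)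
  · simp only [Finset.mem_range] at hi ⊢
    omega
  · simp only [Finset.mem_sdiff, Finset.mem_range, not_lt] at hi
    rw [Nat.descFactorial_eq_zero_iff_lt.2 (by omega)]
    simp
  · simp only [Finset.mem_range] at hi
    have hd := Nat.factorial_mul_descFactorial (n := 2 * n - 2 * i) (k := n + m) (by omega)
    rw [show 2 * n - 2 * i - (n + m) = n - m - 2 * i by omega] at hd ⊢
    rw [legendreCoeff, ← hd]
    congr 2
    have := Nat.factorial_ne_zero (n - m - 2 * i)
    have := Nat.factorial_ne_zero n
    push_cast
    field_simp

/-- For $f=(X^2-1)^n$ one has $(X^2-1)f'=2nXf$; this is that relation differentiated $k+1$ times.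
The case $k=n+m$ is the Gegenbauer equation. -/
theorem iterate_derivative_sq_sub_one_pow (n k : ℕ) :
    (Polynomial.X ^ 2 - 1) *
        Polynomial.derivative^[k + 2] ((Polynomial.X ^ 2 - 1 : Polynomial ℝ) ^ n) =
      Polynomial.C (2 * n - 2 * k - 2 : ℝ) * (Polynomial.X *
          Polynomial.derivative^[k + 1] ((Polynomial.X ^ 2 - 1 : Polynomial ℝ) ^ n)) +
        Polynomial.C ((k + 1) * (2 * n - k) : ℝ) *
          Polynomial.derivative^[k] ((Polynomial.X ^ 2 - 1 : Polynomial ℝ) ^ n) := by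
  induction k with
  | zero =>
    have h : (Polynomial.X ^ 2 - 1) *
        Polynomial.derivative ((Polynomial.X ^ 2 - 1 : Polynomial ℝ) ^ n) =
        Polynomial.C (2 * n : ℝ) * (Polynomial.X * (Polynomial.X ^ 2 - 1 : Polynomial ℝ) ^ n) := by
      cases n with
      | zero => simp
      | succ n =>
        rw [Polynomial.derivative_pow_succ]
        simp [show (Polynomial.C 2 : Polynomial ℝ) = 2 from rfl]
        ring
    have h2 := congrArg Polynomial.derivative h
    simp only [Polynomial.derivative_mul, Polynomial.derivative_sub, Polynomial.derivative_X_pow,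
      Polynomial.derivative_one, Polynomial.derivative_X, Polynomial.derivative_C] at h2
    simp only [Function.iterate_succ_apply', Function.iterate_zero, id]
    simp only [map_sub, map_mul, map_add, map_one, map_natCast, map_ofNat] at h2 ⊢
    push_cast at h2 ⊢
    linear_combination h2
  | succ k ih =>
    have h2 := congrArg Polynomial.derivative ih
    simp only [Polynomial.derivative_mul, Polynomial.derivative_sub, Polynomial.derivative_add,
      Polynomial.derivative_X_pow, Polynomial.derivative_one, Polynomial.derivative_X,
      Polynomial.derivative_C, ← Function.iterate_succ_apply' Polynomial.derivative] at h2
    simp only [map_sub, map_mul, map_add, map_one, map_natCast, map_ofNat] at h2 ⊢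
    push_cast at h2 ⊢
    simp only [Nat.succ_eq_add_one, add_assoc, Nat.reduceAdd] at h2 ⊢
    linear_combination h2

/-- The Gegenbauer differential equation of the derivatives of Legendre polynomials. -/
theorem legendreDeriv_ode (n m : ℕ) :
    (1 - Polynomial.X ^ 2) * legendreDeriv n (m + 2) -
        Polynomial.C (2 * (m + 1) : ℝ) * (Polynomial.X * legendreDeriv n (m + 1)) +
      Polynomial.C ((n - m) * (n + m + 1) : ℝ) * legendreDeriv n m = 0 := by
  have h := iterate_derivative_sq_sub_one_pow n (n + m)
  rw [legendreDeriv_eq_iterate, legendreDeriv_eq_iterate, legendreDeriv_eq_iterate, ← add_assoc,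
    ← add_assoc]
  simp only [map_sub, map_mul, map_add, map_one, map_natCast, map_ofNat, Nat.cast_add] at h ⊢
  linear_combination -Polynomial.C (1 / (2 ^ n * (n.factorial : ℝ))) * h

theorem legendreDeriv_eval_one {n m : ℕ} (h : m ≤ n) :
    (legendreDeriv n m).eval 1 * (2 ^ m * (m.factorial : ℝ) * ((n - m).factorial : ℝ)) =
      ((n + m).factorial : ℝ) := by
  induction m with
  | zero =>
    have e := Polynomial.aeval_iterate_derivative_self (A := ℝ)
      ((Polynomial.X ^ 2 - 1 : Polynomial ℝ) ^ n) n 1 (p' := (Polynomial.X + 1) ^ n) (by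
        simp only [Algebra.algebraMap_self, Polynomial.map_id, map_one]
        rw [← mul_pow]
        ring)
    rw [legendreDeriv_eq_iterate, Polynomial.eval_mul, Polynomial.eval_C]
    simp only [Polynomial.aeval_def, Algebra.algebraMap_self, Polynomial.eval₂_id] at e
    rw [add_zero, e]
    have := Nat.factorial_ne_zero n
    simp
    field_simp
    norm_num
  | succ m ih =>
    have ih := ih (by omega)
    -- At $1$ the second-order term drops out, leaving a first-order recursion in $m$.
    have ode := congrArg (Polynomial.eval 1) (legendreDeriv_ode n m)
    simp only [Polynomial.eval_add, Polynomial.eval_sub, Polynomial.eval_mul, Polynomial.eval_pow,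
      Polynomial.eval_X, Polynomial.eval_one, Polynomial.eval_zero, Polynomial.eval_C] at ode
    obtain ⟨d, rfl⟩ := Nat.exists_eq_add_of_lt h
    rw [show m + d + 1 - m = d + 1 by omega, Nat.factorial_succ] at ih
    rw [show m + d + 1 - (m + 1) = d by omega, ← add_assoc, Nat.factorial_succ,
      Nat.factorial_succ (m + d + 1 + m), Nat.cast_mul, Nat.cast_mul, ← ih]
    push_cast at ode ⊢
    linear_combination (-(2 ^ m * (m.factorial : ℝ) * (d.factorial : ℝ))) * ode

-- The two-variable Gegenbauer equation

local notation "X₀" => (MvPolynomial.X 0 : MvPolynomial (Fin 2) ℝ)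
local notation "X₁" => (MvPolynomial.X 1 : MvPolynomial (Fin 2) ℝ)

/-- The difference of the Gegenbauer operators `(1 - X²) ∂² - 2 (m + 1) X ∂` in the two
variables. -/
def gegenbauerDiff (m : ℕ) (f : MvPolynomial (Fin 2) ℝ) : MvPolynomial (Fin 2) ℝ :=
  (1 - X₀ ^ 2) * MvPolynomial.pderiv 0 (MvPolynomial.pderiv 0 f) -
      2 * ((m : MvPolynomial (Fin 2) ℝ) + 1) * X₀ * MvPolynomial.pderiv 0 f -
    ((1 - X₁ ^ 2) * MvPolynomial.pderiv 1 (MvPolynomial.pderiv 1 f) -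
      2 * ((m : MvPolynomial (Fin 2) ℝ) + 1) * X₁ * MvPolynomial.pderiv 1 f)

theorem gegenbauerDiff_add (m : ℕ) (f g : MvPolynomial (Fin 2) ℝ) :
    gegenbauerDiff m (f + g) = gegenbauerDiff m f + gegenbauerDiff m g := by
  simp only [gegenbauerDiff, map_add]
  ring

theorem gegenbauerDiff_smul (m : ℕ) (c : ℝ) (f : MvPolynomial (Fin 2) ℝ) :
    gegenbauerDiff m (c • f) = c • gegenbauerDiff m f := by
  simp only [gegenbauerDiff, Derivation.map_smul]
  simp only [MvPolynomial.smul_eq_C_mul]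
  ring

theorem gegenbauerDiff_zero (m : ℕ) : gegenbauerDiff m 0 = 0 := by
  simp [gegenbauerDiff]

theorem gegenbauerDiff_sum (m : ℕ) {ι : Type*} (s : Finset ι) (f : ι → MvPolynomial (Fin 2) ℝ) :
    gegenbauerDiff m (∑ i ∈ s, f i) = ∑ i ∈ s, gegenbauerDiff m (f i) := by
  classical
  induction s using Finset.induction_on with
  | empty => simp [gegenbauerDiff_zero]
  | insert a s ha ih => rw [Finset.sum_insert ha, Finset.sum_insert ha, gegenbauerDiff_add, ih]

/-- The factor theorem: modulo $X_0-1$ the substitution $X_0\mapsto1$ is the identity. -/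
theorem X_zero_sub_one_dvd_of_bind₁_eq_zero {f : MvPolynomial (Fin 2) ℝ}
    (h : MvPolynomial.bind₁ ![1, X₁] f = (0 : MvPolynomial (Fin 2) ℝ)) :
    X₀ - 1 ∣ f := by
  have key : (Ideal.Quotient.mkₐ ℝ
        (Ideal.span {X₀ - 1})).comp
          (MvPolynomial.bind₁ ![1, X₁]) =
      Ideal.Quotient.mkₐ ℝ _ := by
    refine MvPolynomial.algHom_ext fun i => ?_
    fin_cases i
    · simp only [AlgHom.comp_apply, Fin.zero_eta, MvPolynomial.bind₁_X_right, Matrix.cons_val_zero,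
        Ideal.Quotient.mkₐ_eq_mk]
      rw [eq_comm, Ideal.Quotient.eq]
      exact Ideal.mem_span_singleton_self _
    · simp
  have := AlgHom.congr_fun key f
  rw [AlgHom.comp_apply, h, map_zero, eq_comm, Ideal.Quotient.mkₐ_eq_mk,
    Ideal.Quotient.eq_zero_iff_mem, Ideal.mem_span_singleton] at this
  exact this

/-- The indicial equation at $X_0=1$ is $r(r+m)=0$, which has no positive root. A solution divisible
by $X_0-1$ is therefore divisible by all its powers. -/
theorem X_zero_sub_one_pow_dvd {m : ℕ} {f : MvPolynomial (Fin 2) ℝ} (hf : gegenbauerDiff m f = 0)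
    (h : X₀ - 1 ∣ f) (k : ℕ) :
    (X₀ - 1) ^ (k + 1) ∣ f := by
  induction k with
  | zero => simpa using h
  | succ k ih =>
    obtain ⟨g, rfl⟩ := ih
    rw [pow_succ _ (k + 1)]
    refine mul_dvd_mul_left _ ?_
    have hd0 : ∀ j : ℕ, MvPolynomial.pderiv (0 : Fin 2)
        ((X₀ - 1) ^ (j + 1)) =
        ((j : MvPolynomial (Fin 2) ℝ) + 1) * (X₀ - 1) ^ j := by
      intro j
      rw [Derivation.leibniz_pow]
      simp
    have hd1 : MvPolynomial.pderiv (1 : Fin 2)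
        ((X₀ - 1) ^ (k + 1)) = 0 := by
      rw [Derivation.leibniz_pow]
      simp
    have hn : ∀ i : Fin 2, MvPolynomial.pderiv i ((k : MvPolynomial (Fin 2) ℝ) + 1) = 0 := by
      intro i
      simp
    have hz : (X₀ - 1) ^ k ≠ 0 := by
      refine pow_ne_zero _ fun h0 => ?_
      have := congrArg (MvPolynomial.eval 0) h0
      simp at this
    -- The extra factor $X_0-1$, taken from $1-X_0^2$, avoids the exponent $k-1$.
    have hdd : MvPolynomial.pderiv (0 : Fin 2)
        (((k : MvPolynomial (Fin 2) ℝ) + 1) * (X₀ - 1) ^ k) * (X₀ - 1) =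
        ((k : MvPolynomial (Fin 2) ℝ) + 1) * (k : MvPolynomial (Fin 2) ℝ) * (X₀ - 1) ^ k := by
      rw [Derivation.leibniz, hn]
      cases k with
      | zero => simp
      | succ k =>
        rw [hd0]
        simp only [smul_eq_mul]
        push_cast
        ring
    -- The lowest-order part of the equation in powers of $X_0-1$: the indicial polynomial at
    -- $r=k+1$, doubled, multiplies $g$.
    have e : 2 * ((k : MvPolynomial (Fin 2) ℝ) + 1) * (k + m + 1) * g =
        (X₀ - 1) * (
          -((k : MvPolynomial (Fin 2) ℝ) + 1) * (k + 2 * m + 2) * g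
          - 2 * ((m : MvPolynomial (Fin 2) ℝ) + 1) * X₀ * MvPolynomial.pderiv 0 g
          - 2 * ((k : MvPolynomial (Fin 2) ℝ) + 1) * (1 + X₀) * MvPolynomial.pderiv 0 g
          + (1 - X₀ ^ 2) * MvPolynomial.pderiv 0 (MvPolynomial.pderiv 0 g) -
            ((1 - X₁ ^ 2) * MvPolynomial.pderiv 1 (MvPolynomial.pderiv 1 g) -
            2 * ((m : MvPolynomial (Fin 2) ℝ) + 1) * X₁ * MvPolynomial.pderiv 1 g)) := by
      refine mul_left_cancel₀ hz ?_
      simp only [gegenbauerDiff, Derivation.leibniz, hd1, smul_eq_mul, map_add, mul_zero,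
        add_zero] at hf
      rw [hd0] at hf
      linear_combination -hf - g * (1 + X₀) * hdd
    have hu : IsUnit (2 * ((k : MvPolynomial (Fin 2) ℝ) + 1) * (k + m + 1)) := by
      have : (2 * ((k : MvPolynomial (Fin 2) ℝ) + 1) * (k + m + 1)) =
          MvPolynomial.C (σ := Fin 2) (2 * ((k : ℝ) + 1) * (k + m + 1)) := by
        simp only [map_mul, map_add, map_natCast, map_one, map_ofNat]
      rw [this]
      exact (IsUnit.mk0 _ (by positivity)).map MvPolynomial.C
    exact hu.dvd_mul_left.1 ⟨_, e⟩

/-- A polynomial annihilated by the difference of the Gegenbauer operators is determined by its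
values at `1` in the first variable. -/
theorem eq_zero_of_gegenbauerDiff_eq_zero {m : ℕ} {f : MvPolynomial (Fin 2) ℝ}
    (hf : gegenbauerDiff m f = 0)
    (h : MvPolynomial.bind₁ ![1, X₁] f = (0 : MvPolynomial (Fin 2) ℝ)) :
    f = 0 := by
  by_contra h0
  have hu : ¬ IsUnit (X₀ - 1) := by
    intro hu
    have := hu.map (MvPolynomial.eval (fun _ : Fin 2 => (1 : ℝ)))
    simp at this
  obtain ⟨k, hk⟩ := FiniteMultiplicity.of_not_isUnit hu h0
  exact hk (X_zero_sub_one_pow_dvd hf (X_zero_sub_one_dvd_of_bind₁_eq_zero h) k)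

/-- Both factors are eigenfunctions of their Gegenbauer operators, with the same eigenvalue. -/
theorem gegenbauerDiff_legendreDeriv_mul (n m : ℕ) :
    gegenbauerDiff m (Polynomial.aeval (X₀) (legendreDeriv n m) *
      Polynomial.aeval (X₁) (legendreDeriv n m)) = 0 := by
  have hd : ∀ (i j : Fin 2) (k : ℕ), MvPolynomial.pderiv i
      (Polynomial.aeval (MvPolynomial.X j : MvPolynomial (Fin 2) ℝ) (legendreDeriv n k)) =
      if i = j then Polynomial.aeval (MvPolynomial.X j) (legendreDeriv n (k + 1)) else 0 := by
    intro i j k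
    rw [Derivation.map_aeval, ← legendreDeriv_succ, MvPolynomial.pderiv_X, Pi.single_apply]
    split_ifs with h1 h2 h2
    · simp
    · exact absurd h1.symm h2
    · exact absurd h2.symm h1
    · simp
  have ode : ∀ j : Fin 2, _ := fun j => congrArg (Polynomial.aeval
    (MvPolynomial.X j : MvPolynomial (Fin 2) ℝ)) (legendreDeriv_ode n m)
  have o0 := ode 0
  have o1 := ode 1
  simp only [map_add, map_sub, map_mul, map_pow, map_one, map_zero, Polynomial.aeval_X,
    Polynomial.aeval_C] at o0 o1
  simp only [gegenbauerDiff, Derivation.leibniz, hd, smul_eq_mul, mul_zero,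
    add_zero, zero_add, if_true, zero_ne_one, one_ne_zero, if_false]
  simp only [map_ofNat, map_natCast] at o0 o1
  linear_combination (Polynomial.aeval (X₁) (legendreDeriv n m)) * o0 -
    (Polynomial.aeval (X₀) (legendreDeriv n m)) * o1

/-- Up to the factor $X_1^2-X_0^2$, this is the Laplacian of $(x_1+ix_2)^m x_0^p|x|^{2i}$ in
disguise, with $x_0=X_0X_1$ and $|x|^2=X_0^2+X_1^2-1$. Truncated exponents do no harm: their
coefficients vanish. -/
theorem gegenbauerDiff_monomial (m p i : ℕ) :
    gegenbauerDiff m ((X₀ * X₁) ^ p *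
        (X₀ ^ 2 + X₁ ^ 2 - 1) ^ i) =
      (X₁ ^ 2 - X₀ ^ 2) *
        (MvPolynomial.C ((p : ℝ) * (p - 1)) * ((X₀ * X₁) ^ (p - 2) *
          (X₀ ^ 2 + X₁ ^ 2 - 1) ^ i) +
        MvPolynomial.C ((i : ℝ) * (4 * p + 4 * i + 4 * m + 2)) * ((X₀ * X₁) ^ p *
          (X₀ ^ 2 + X₁ ^ 2 - 1) ^ (i - 1))) := by
  have h01 : MvPolynomial.pderiv (0 : Fin 2) X₁ = 0 :=
    MvPolynomial.pderiv_X_of_ne (by decide)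
  have h10 : MvPolynomial.pderiv (1 : Fin 2) X₀ = 0 :=
    MvPolynomial.pderiv_X_of_ne (by decide)
  have hn : ∀ (i : Fin 2) (k : ℕ), MvPolynomial.pderiv i (k : MvPolynomial (Fin 2) ℝ) = 0 := by
    intro i k
    simp
  have h2 : ∀ i : Fin 2, MvPolynomial.pderiv i (2 : MvPolynomial (Fin 2) ℝ) = 0 := fun i => hn i 2
  have hp : ∀ p : ℕ, p + 1 + 1 - 2 = p := fun _ => rfl
  rcases p with _ | _ | p <;> rcases i with _ | _ | i <;>
  · simp only [gegenbauerDiff, Derivation.leibniz, Derivation.leibniz_pow, map_add, map_sub,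
      h01, h10, MvPolynomial.pderiv_X_self, smul_eq_mul, nsmul_eq_mul, pow_zero, hn,
      h2, hp, map_mul, map_natCast, map_one, map_ofNat, 
      Derivation.map_one_eq_zero, zero_add, Nat.cast_add, Nat.cast_one,
      Nat.cast_zero, map_zero, mul_zero, add_zero, Nat.cast_ofNat, pow_one, Nat.add_one_sub_one,
      zero_mul, Nat.sub_self, Nat.reduceSub]
    ring

/-! ### Zonal polynomials and the product formula -/

/-- The recursion that makes consecutive terms cancel in `gegenbauerDiff_solidPoly`. -/
theorem legendreCoeff_succ {n m i : ℕ} (h : 2 * (i + 1) + m ≤ n) :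
    legendreCoeff n m (i + 1) * ((i + 1) * (4 * n - 4 * i - 2)) =
      -(legendreCoeff n m i * ((n - m - 2 * i) * (n - m - 2 * i - 1))) := by
  obtain ⟨d, rfl⟩ := Nat.exists_eq_add_of_le h
  have hc := Nat.choose_succ_right_eq (2 * (i + 1) + m + d) i
  have hc' : ((2 * (i + 1) + m + d).choose (i + 1) : ℝ) * (i + 1) =
      ((2 * (i + 1) + m + d).choose i : ℝ) * (i + 2 + m + d) := by
    rw [show 2 * (i + 1) + m + d - i = i + 2 + m + d by omega] at hc
    exact_mod_cast hc
  rw [legendreCoeff, legendreCoeff, show 2 * (i + 1) + m + d - m - 2 * (i + 1) = d by omega,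
    show 2 * (i + 1) + m + d - m - 2 * i = d + 1 + 1 by omega,
    show 2 * (2 * (i + 1) + m + d) - 2 * (i + 1) = 2 * (i + 1 + m + d) by omega,
    show 2 * (2 * (i + 1) + m + d) - 2 * i = 2 * (i + 1 + m + d) + 1 + 1 by omega]
  simp only [Nat.factorial_succ (d + 1), Nat.factorial_succ d,
    Nat.factorial_succ (2 * (i + 1 + m + d) + 1), Nat.factorial_succ (2 * (i + 1 + m + d))]
  have f0 := Nat.factorial_ne_zero d
  have f1 := Nat.factorial_ne_zero (2 * (i + 1) + m + d)
  generalize ((2 * (i + 1 + m + d)).factorial) = a at *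
  generalize ((2 * (i + 1) + m + d).factorial) = b at *
  generalize ((2 * (i + 1) + m + d).choose (i + 1)) = c at *
  generalize ((2 * (i + 1) + m + d).choose i) = c' at *
  have e : (4 * ((2 * (i + 1) + m + d : ℕ) : ℝ) - 4 * i - 2) = 4 * i + 4 * m + 4 * d + 6 := by
    push_cast
    ring
  have e2 : (((2 * (i + 1) + m + d : ℕ) : ℝ) - m - 2 * i) = d + 1 + 1 := by
    push_cast
    ring
  rw [e, e2]
  push_cast
  field_simp
  rw [pow_succ]
  linear_combination (-(-1) ^ i * a * (d + 1) * (4 * i + 4 * m + 4 * d + 6)) * hc'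

/-- The solid zonal polynomial `y^((n-m)/2) P_n^(m)(x / y^(1/2))`. -/
def solidPoly {A : Type*} [CommRing A] [Algebra ℝ A] (n m : ℕ) (x y : A) : A :=
  if m ≤ n then ∑ i ∈ Finset.range ((n - m) / 2 + 1),
    legendreCoeff n m i • (x ^ (n - m - 2 * i) * y ^ i) else 0

theorem map_solidPoly {A B : Type*} [CommRing A] [Algebra ℝ A] [CommRing B] [Algebra ℝ B]
    (f : A →ₐ[ℝ] B) (n m : ℕ) (x y : A) :
    f (solidPoly n m x y) = solidPoly n m (f x) (f y) := by
  unfold solidPoly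
  split_ifs <;> simp

theorem gegenbauerDiff_solidPoly (n m : ℕ) :
    gegenbauerDiff m (solidPoly n m (X₀ * X₁) (X₀ ^ 2 + X₁ ^ 2 - 1)) = 0 := by
  unfold solidPoly
  split_ifs with h
  swap
  · exact gegenbauerDiff_zero m
  -- The partial sums telescope to one boundary term. At the last index $n-m-2I$ is $0$ or $1$, so
  -- this term vanishes too.
  have key : ∀ I, 2 * I + m ≤ n → ∑ i ∈ Finset.range (I + 1), gegenbauerDiff m
      (legendreCoeff n m i • ((X₀ * X₁) ^ (n - m - 2 * i) * (X₀ ^ 2 + X₁ ^ 2 - 1) ^ i)) =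
      (X₁ ^ 2 - X₀ ^ 2) *
        MvPolynomial.C (legendreCoeff n m I * ((n - m - 2 * I) * (n - m - 2 * I - 1))) *
        ((X₀ * X₁) ^ (n - m - 2 * I - 2) * (X₀ ^ 2 + X₁ ^ 2 - 1) ^ I) := by
    intro I hI
    induction I with
    | zero =>
      rw [Finset.sum_range_one, gegenbauerDiff_smul, gegenbauerDiff_monomial,
        MvPolynomial.smul_eq_C_mul]
      simp only [mul_zero, Nat.sub_zero, Nat.cast_sub h, Nat.cast_zero, zero_mul, map_zero,
        add_zero, sub_zero, map_mul]
      ring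
    | succ I ih =>
      rw [Finset.sum_range_succ, ih (by omega), gegenbauerDiff_smul, gegenbauerDiff_monomial,
        MvPolynomial.smul_eq_C_mul, show n - m - 2 * I - 2 = n - m - 2 * (I + 1) by omega,
        Nat.add_sub_cancel, Nat.cast_sub (by omega), Nat.cast_sub h]
      have hc := congrArg (MvPolynomial.C (σ := Fin 2)) (legendreCoeff_succ hI)
      rw [show ((I + 1 : ℕ) : ℝ) * (4 * (n - m - (2 * (I + 1) : ℕ)) + 4 * (I + 1 : ℕ) + 4 * m + 2)
        = (I + 1) * (4 * n - 4 * I - 2) by push_cast; ring]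
      simp only [map_mul, map_neg] at hc ⊢
      push_cast
      linear_combination (X₁ ^ 2 - X₀ ^ 2) * ((X₀ * X₁) ^ (n - m - 2 * (I + 1)) *
        (X₀ ^ 2 + X₁ ^ 2 - 1) ^ I) * hc
  rw [gegenbauerDiff_sum, key _ (by omega)]
  have hz : ((n : ℝ) - m - 2 * ((n - m) / 2 : ℕ)) * (n - m - 2 * ((n - m) / 2 : ℕ) - 1) = 0 := by
    rw [← Nat.cast_sub h]
    rcases Nat.even_or_odd' (n - m) with ⟨c, hc | hc⟩
    · rw [hc, show 2 * c / 2 = c by omega]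
      push_cast
      ring
    · rw [hc, show (2 * c + 1) / 2 = c by omega]
      push_cast
      ring
  rw [hz]
  simp

/-- Equality of the coefficients of $X_1^{n-m-2k}$ in the product formula restricted to $X_0=1$;
this fixes `uCoeff`. -/
theorem legendreCoeff_mul_eval_one {n m k : ℕ} (h : 2 * k + m ≤ n) :
    ((n - m).factorial : ℝ) / (2 ^ n * poch (1 / 2) n) *
        ((legendreDeriv n m).eval 1 * legendreCoeff n m k) =
      uCoeff n m k * (legendreDeriv (n - 2 * k) m).eval 1 := by
  have h1 := legendreDeriv_eval_one (n := n) (m := m) (by omega)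
  have h2 := legendreDeriv_eval_one (n := n - 2 * k) (m := m) (by omega)
  have e2 : poch ((n : ℝ) + m - 2 * k + 1) (2 * k) * ((n - 2 * k + m).factorial : ℝ) =
      ((n + m).factorial : ℝ) := by
    have := poch_natCast_add_one (n + m - 2 * k) (2 * k)
    rw [Nat.sub_add_cancel (by omega), Nat.cast_sub (by omega),
      show n + m - 2 * k = n - 2 * k + m by omega] at this
    push_cast at this
    exact this
  have hp := poch_half_mul (n - k)
  have hc : (n.choose k : ℝ) = n.factorial / (k.factorial * (n - k).factorial) :=
    Nat.cast_choose ℝ (by omega)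
  have n0 := poch_half_ne_zero n
  have f0 := Nat.factorial_ne_zero n
  have f1 := Nat.factorial_ne_zero m
  have f2 := Nat.factorial_ne_zero k
  have f3 := Nat.factorial_ne_zero (n - k)
  have f4 := Nat.factorial_ne_zero (n - m)
  have f5 := Nat.factorial_ne_zero (n - 2 * k - m)
  rw [← eq_div_iff (by positivity)] at h1 h2
  have e4 : (4 : ℝ) ^ n = 4 ^ k * 4 ^ (n - k) := by rw [← pow_add]; congr 1; omega
  have e5 : (4 : ℝ) ^ n = 2 ^ n * 2 ^ n := by rw [← mul_pow]; norm_num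
  have hs : ((-1 : ℝ) ^ k) ≠ 0 := by simp
  have hss : ((-1 : ℝ) ^ k) * (-1) ^ k = 1 := by rw [← mul_pow]; simp
  rw [uCoeff, if_pos ⟨by omega, by omega⟩, legendreCoeff, h1, h2, ← e2, hc,
    show 2 * n - 2 * k = 2 * (n - k) by omega, ← hp, show n - m - 2 * k = n - 2 * k - m by omega,
    show (-4 : ℝ) = -1 * 4 by norm_num, mul_pow]
  rw [e5] at e4
  generalize poch ((n : ℝ) + m - 2 * k + 1) (2 * k) = q at *
  generalize poch (1 / 2) n = p at *
  generalize poch (1 / 2) (n - k) = p' at *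
  generalize (-1 : ℝ) ^ k = s at *
  field_simp
  linear_combination (q * p' * 4 ^ (n - k) * 4 ^ k) * hss - q * p' * e4

/-- The product formula behind the conversion of spheroidal into spherical harmonics. -/
theorem legendreDeriv_mul_legendreDeriv {n m : ℕ} (h : m ≤ n) :
    (((n - m).factorial : ℝ) / (2 ^ n * poch (1 / 2) n)) •
        (Polynomial.aeval X₀ (legendreDeriv n m) * Polynomial.aeval X₁ (legendreDeriv n m)) =
      ∑ k ∈ Finset.range ((n - m) / 2 + 1),
        uCoeff n m k • solidPoly (n - 2 * k) m (X₀ * X₁) (X₀ ^ 2 + X₁ ^ 2 - 1) := by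
  rw [← sub_eq_zero]
  refine eq_zero_of_gegenbauerDiff_eq_zero (m := m) ?_ ?_
  · rw [sub_eq_add_neg, ← neg_one_smul ℝ (Finset.sum _ _), gegenbauerDiff_add,
      gegenbauerDiff_smul, gegenbauerDiff_smul, gegenbauerDiff_legendreDeriv_mul,
      gegenbauerDiff_sum, Finset.sum_eq_zero]
    · simp
    · intro k _
      rw [gegenbauerDiff_smul, gegenbauerDiff_solidPoly, smul_zero]
  · rw [map_sub, sub_eq_zero, map_smul, map_mul, map_sum, ← Polynomial.aeval_algHom_apply,
      ← Polynomial.aeval_algHom_apply]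
    simp only [map_smul, map_solidPoly, map_mul, map_sub, map_add, map_pow, map_one,
      MvPolynomial.bind₁_X_right, Matrix.cons_val_zero, Matrix.cons_val_one, one_mul, one_pow,
      add_sub_cancel_left]
    have h1 : Polynomial.aeval (1 : MvPolynomial (Fin 2) ℝ) (legendreDeriv n m) =
        MvPolynomial.C ((legendreDeriv n m).eval 1) := by
      rw [← map_one (algebraMap ℝ (MvPolynomial (Fin 2) ℝ)), Polynomial.aeval_algebraMap_apply]
      simp [MvPolynomial.algebraMap_eq]
    have h2 : Polynomial.aeval X₁ (legendreDeriv n m) =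
        ∑ k ∈ Finset.range ((n - m) / 2 + 1), legendreCoeff n m k • X₁ ^ (n - m - 2 * k) := by
      rw [legendreDeriv_eq_sum h, map_sum]
      simp [MvPolynomial.algebraMap_eq, MvPolynomial.smul_eq_C_mul]
    rw [h1, h2, ← MvPolynomial.smul_eq_C_mul, smul_smul, Finset.smul_sum]
    refine Finset.sum_congr rfl fun k hk => ?_
    have hk : 2 * k + m ≤ n := by
      have := Finset.mem_range.1 hk
      omega
    -- At $X_0=1$ the second argument is the square of the first, so by homogeneity each zonal
    -- polynomial collapses to a single power.
    have h3 : solidPoly (n - 2 * k) m X₁ (X₁ ^ 2) =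
        (legendreDeriv (n - 2 * k) m).eval 1 • X₁ ^ (n - m - 2 * k) := by
      rw [solidPoly, if_pos (by omega), legendreDeriv_eq_sum (by omega),
        Polynomial.eval_finsetSum, Finset.sum_smul]
      refine Finset.sum_congr rfl fun i hi => ?_
      have := Finset.mem_range.1 hi
      rw [← pow_mul, ← pow_add, show n - 2 * k - m - 2 * i + 2 * i = n - m - 2 * k by omega]
      simp
    rw [h3, smul_smul, smul_smul, ← legendreCoeff_mul_eval_one hk, mul_assoc]

/-! ### Telescoping and terminating hypergeometric sums -/

/-- The telescoping sum behind the inversion of the conversion formulas. -/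
theorem sum_alternating_choose_div_poch (β : ℝ) (hβ : ∀ i : ℕ, β + i ≠ 0) (M I : ℕ) :
    ∑ i ∈ Finset.range (I + 1), (-1) ^ i * ((M + 1).choose i : ℝ) * (β + 2 * i) /
        poch (β + i) (M + 2) =
      (-1) ^ I * (M.choose I : ℝ) / poch (β + I + 1) (M + 1) := by
  have hp : ∀ (j k : ℕ), poch (β + j) k ≠ 0 := fun j k => poch_ne_zero fun i _ => by
    have := hβ (j + i)
    push_cast at this
    rwa [add_assoc]
  induction I with
  | zero =>
    have h0 := hp 0 (M + 2)
    have h1 := hp 1 (M + 1)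
    have e : poch β (M + 2) = β * poch (β + 1) (M + 1) := by
      rw [show M + 2 = 1 + (M + 1) by ring, poch_add, poch_one, Nat.cast_one]
    simp only [Nat.cast_zero, add_zero, Nat.cast_one] at h0 h1
    simp
    rw [e] at h0 ⊢
    have := left_ne_zero_of_mul h0
    field_simp
  | succ I ih =>
    rw [Finset.sum_range_succ, ih]
    -- Splitting off the last factor here, and the first in `e2`, gives the old and new closed forms
    -- a common denominator. What remains is $\binom MI(M-I)=\binom M{I+1}(I+1)$.
    have e1 : poch (β + (I + 1 : ℕ)) (M + 2) =
        poch (β + I + 1) (M + 1) * (β + I + 1 + (M + 1)) := by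
      rw [show M + 2 = (M + 1) + 1 by ring, poch_succ]
      push_cast
      ring_nf
    have e2 : poch (β + (I + 1 : ℕ)) (M + 2) =
        (β + I + 1) * poch (β + (I + 1 : ℕ) + 1) (M + 1) := by
      rw [show M + 2 = 1 + (M + 1) by ring, poch_add, poch_one]
      push_cast
      ring
    have n0 := hp (I + 1) (M + 2)
    have n1 := hp (I + 1) (M + 1)
    have n2 : poch (β + (I + 1 : ℕ) + 1) (M + 1) ≠ 0 := right_ne_zero_of_mul (e2 ▸ n0)
    push_cast at n1 n2
    have c : ((M + 1).choose (I + 1) : ℝ) = (M.choose I : ℝ) + (M.choose (I + 1) : ℝ) := by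
      rw [Nat.choose_succ_succ]
      push_cast
      ring
    have c2 : ((M.choose I : ℝ)) * (M - I) = (M.choose (I + 1) : ℝ) * (I + 1) := by
      rcases le_or_gt I M with h | h
      · have := Nat.choose_succ_right_eq M I
        rw [← Nat.cast_sub h]
        exact_mod_cast this.symm
      · rw [Nat.choose_eq_zero_of_lt h, Nat.choose_eq_zero_of_lt (by omega : M < I + 1)]
        simp
    have f1 : 1 / poch (β + I + 1) (M + 1) =
        (β + I + 1 + (M + 1)) / poch (β + (I + 1 : ℕ)) (M + 2) := by
      rw [div_eq_div_iff (by rwa [add_assoc]) n0, e1]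
      ring
    have f2 : 1 / poch (β + (I + 1 : ℕ) + 1) (M + 1) =
        (β + I + 1) / poch (β + (I + 1 : ℕ)) (M + 2) := by
      rw [div_eq_div_iff (by exact_mod_cast n2) n0, e2]
      ring
    rw [div_eq_mul_one_div, f1, c, div_eq_mul_one_div _ (poch (β + (I + 1 : ℕ) + 1) (M + 1)), f2,
      mul_div_assoc', mul_div_assoc', ← add_div]
    congr 1
    push_cast
    rw [pow_succ]
    linear_combination (-1) ^ I * c2

theorem sum_alternating_choose_div_poch_eq (β : ℝ) (hβ : ∀ i : ℕ, β + i ≠ 0) (M : ℕ) :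
    ∑ i ∈ Finset.range (M + 1), (-1) ^ i * (M.choose i : ℝ) * (β + 2 * i) /
        poch (β + i) (M + 1) = if M = 0 then 1 else 0 := by
  cases M with
  | zero =>
    have := hβ 0
    simp at this
    simp [poch_succ, poch_zero, this]
  | succ M =>
    -- The closed form carries $\binom{M}{M+1}=0$.
    rw [sum_alternating_choose_div_poch β hβ M (M + 1)]
    simp

theorem poch_neg_natCast (k j : ℕ) :
    poch (-(k : ℝ)) j = (-1) ^ j * (k.descFactorial j : ℝ) := by
  induction j with
  | zero => simp [poch_zero]
  | succ j ih =>
    rw [poch_succ, ih, Nat.descFactorial_succ]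
    rcases le_or_gt j k with h | h
    · push_cast [Nat.cast_sub h]
      ring
    · rw [Nat.descFactorial_eq_zero_iff_lt.2 h]
      simp

/-- The bound $K$ may exceed $k$, so that series with different $k$ share one range and their sums
can be interchanged. -/
theorem ordinaryHypergeometric_neg_natCast {k K : ℕ} (h : k ≤ K) (b c x : ℝ) :
    ₂F₁ (-(k : ℝ)) b c x = ∑ j ∈ Finset.range (K + 1),
      poch (-(k : ℝ)) j * poch b j / (poch c j * (j.factorial : ℝ)) * x ^ j := by
  rw [ordinaryHypergeometric_eq_tsum]
  simp only
  rw [tsum_eq_sum (s := Finset.range (K + 1))]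
  · refine Finset.sum_congr rfl fun j _ => ?_
    simp only [poch, smul_eq_mul]
    field_simp
  · intro j hj
    have : poch (-(k : ℝ)) j = 0 := by
      rw [poch_neg_natCast, Nat.descFactorial_eq_zero_iff_lt.2 (by
        simp only [Finset.mem_range] at hj
        omega)]
      simp
    rw [poch] at this
    simp [this]

theorem sum_poch_div_eq (α : ℝ) (hα : ∀ i : ℕ, α + i ≠ 0) {j K : ℕ} (h : j ≤ K) :
    ∑ k ∈ Finset.range (K + 1), poch (-(k : ℝ)) j * poch (α + k) j *
        ((-1) ^ k * (α + 2 * k) / ((k.factorial : ℝ) * ((K - k).factorial : ℝ) *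
          poch (α + k) (K + 1))) = if j = K then 1 else 0 := by
  obtain ⟨M, rfl⟩ := Nat.exists_eq_add_of_le h
  -- Only $k\ge j$ contribute; the shift $k=j+i$ turns $\alpha+2k$ into $\beta+2i$ with
  -- $\beta=\alpha+2j$.
  have hM := sum_alternating_choose_div_poch_eq (α + 2 * j) (fun i => by
    have := hα (2 * j + i)
    push_cast at this
    rwa [add_assoc]) M
  rw [add_assoc, Finset.sum_range_add, Finset.sum_eq_zero (s := Finset.range j), zero_add]
  · have : (if j = j + M then (1 : ℝ) else 0) =
        (1 / (M.factorial : ℝ)) * if M = 0 then 1 else 0 := by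
      rcases Nat.eq_zero_or_pos M with rfl | hM
      · simp
      · rw [if_neg (by omega), if_neg (by omega), mul_zero]
    rw [this, ← hM, Finset.mul_sum]
    refine Finset.sum_congr rfl fun i hi => ?_
    have hi : i ≤ M := Nat.lt_succ_iff.1 (Finset.mem_range.1 hi)
    have f0 := Nat.factorial_ne_zero i
    have f1 := Nat.factorial_ne_zero (M - i)
    have f2 := Nat.factorial_ne_zero M
    have f3 := Nat.factorial_ne_zero (j + i)
    have hd : ((i.factorial : ℝ)) * ((j + i).descFactorial j : ℝ) = ((j + i).factorial : ℝ) := by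
      have := Nat.factorial_mul_descFactorial (n := j + i) (k := j) (by omega)
      rw [Nat.add_sub_cancel_left] at this
      exact_mod_cast this
    have hc : (M.choose i : ℝ) = M.factorial / (i.factorial * (M - i).factorial) := by
      rw [Nat.cast_choose ℝ hi]
    have hp : ∀ l k : ℕ, poch (α + l) k ≠ 0 := fun l k => poch_ne_zero fun i _ => by
      have := hα (l + i)
      push_cast at this
      rwa [add_assoc]
    have e : poch (α + (j + i : ℕ)) (j + (M + 1)) =
        poch (α + (j + i : ℕ)) j * poch (α + 2 * j + i) (M + 1) := by
      rw [poch_add]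
      congr 2
      push_cast
      ring
    have n0 := hp (j + i) j
    have n1 := hp (2 * j + i) (M + 1)
    rw [show α + (2 * j + i : ℕ) = α + 2 * j + i by push_cast; ring] at n1
    rw [e, poch_neg_natCast, hc, ← hd,
      show j + M - (j + i) = M - i by omega]
    have f4 : ((j + i).descFactorial j : ℝ) ≠ 0 := by
      intro h0
      rw [h0, mul_zero] at hd
      exact Nat.factorial_ne_zero _ (by exact_mod_cast hd.symm)
    field_simp
    rw [pow_add]
    push_cast
    have : ((-1 : ℝ) ^ j) * (-1) ^ j = 1 := by rw [← mul_pow]; simp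
    linear_combination ((-1) ^ i * (α + 2 * j + 2 * i)) * this
  · intro k hk
    rw [poch_neg_natCast, Nat.descFactorial_eq_zero_iff_lt.2 (Finset.mem_range.1 hk)]
    simp

/-- After the series are expanded and the sums exchanged, `sum_poch_div_eq` leaves only the power
$t^K$. -/
theorem sum_ordinaryHypergeometric_div_poch (α : ℝ) (hα : ∀ i : ℕ, α + i ≠ 0) (K : ℕ) (t : ℝ) :
    ∑ k ∈ Finset.range (K + 1), ₂F₁ (-(k : ℝ)) (α + k) (α + 1) t *
        ((-1) ^ k * (α + 2 * k) / ((k.factorial : ℝ) * ((K - k).factorial : ℝ) *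
          poch (α + k) (K + 1))) = t ^ K / (poch (α + 1) K * (K.factorial : ℝ)) := by
  have : ∀ k ∈ Finset.range (K + 1), ₂F₁ (-(k : ℝ)) (α + k) (α + 1) t *
        ((-1) ^ k * (α + 2 * k) / ((k.factorial : ℝ) * ((K - k).factorial : ℝ) *
          poch (α + k) (K + 1))) = ∑ j ∈ Finset.range (K + 1),
      t ^ j / (poch (α + 1) j * (j.factorial : ℝ)) * (poch (-(k : ℝ)) j * poch (α + k) j *
        ((-1) ^ k * (α + 2 * k) / ((k.factorial : ℝ) * ((K - k).factorial : ℝ) *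
          poch (α + k) (K + 1)))) := by
    intro k hk
    rw [ordinaryHypergeometric_neg_natCast (Nat.lt_succ_iff.1 (Finset.mem_range.1 hk)),
      Finset.sum_mul]
    exact Finset.sum_congr rfl fun j _ => by ring
  rw [Finset.sum_congr rfl this, Finset.sum_comm]
  simp only [← Finset.mul_sum]
  rw [Finset.sum_congr rfl fun j hj => by
    rw [sum_poch_div_eq α hα (Nat.lt_succ_iff.1 (Finset.mem_range.1 hj))]]
  simp

/-! ### Composition of the conversion coefficients -/

/-- Reflection of the half-integer Pochhammer symbols; here and in `wConst_eq` it brings the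
constants to the shape of the hypergeometric summation. -/
theorem uCoeff_eq {n m k : ℕ} (h : 2 * k + m ≤ n) :
    uCoeff n m k = ((n + m).factorial : ℝ) / ((n + m - 2 * k).factorial : ℝ) /
      (4 ^ k * (k.factorial : ℝ) * poch (1 / 2 - n) k) := by
  have e1 : poch (1 / 2) n = poch (1 / 2) (n - k) * ((-1) ^ k * poch (1 / 2 - n) k) := by
    conv_lhs => rw [show n = n - k + k by omega, poch_add]
    rw [poch_reflect (1 / 2 + ((n - k : ℕ) : ℝ)), Nat.cast_sub (by omega)]
    congr 3
    ring
  have e2 : poch ((n : ℝ) + m - 2 * k + 1) (2 * k) * ((n + m - 2 * k).factorial : ℝ) =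
      ((n + m).factorial : ℝ) := by
    have := poch_natCast_add_one (n + m - 2 * k) (2 * k)
    rw [Nat.sub_add_cancel (by omega), Nat.cast_sub (by omega)] at this
    push_cast at this
    exact this
  have n0 := poch_half_ne_zero n
  have n1 := poch_half_ne_zero (n - k)
  rw [e1] at n0
  have n2 := right_ne_zero_of_mul (right_ne_zero_of_mul n0)
  have f0 := Nat.factorial_ne_zero k
  have f1 := Nat.factorial_ne_zero (n + m - 2 * k)
  rw [uCoeff, if_pos ⟨by omega, by omega⟩, e1, ← e2, show (-4 : ℝ) = -1 * 4 by norm_num, mul_pow]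
  have : ((-1 : ℝ) ^ k) * (-1) ^ k = 1 := by rw [← mul_pow]; simp
  have hs : ((-1 : ℝ) ^ k) ≠ 0 := by simp
  generalize (-1 : ℝ) ^ k = s at *
  generalize poch (1 / 2 - (n : ℝ)) k = p at *
  generalize poch ((n : ℝ) + m - 2 * k + 1) (2 * k) = q at *
  field_simp
  linear_combination -q * this

theorem wConst_eq {n m k : ℕ} (h : 2 * k + m ≤ n + 1) :
    wConst n m k = (-1) ^ k * ((n + 1 + m).factorial : ℝ) / ((n + 1 + m - 2 * k).factorial : ℝ) /
      (4 ^ k * (k.factorial : ℝ) * poch (-(n : ℝ) - 3 / 2 + k) k) := by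
  have e1 : poch (1 / 2) (n + 2 - k) =
      poch (1 / 2) (n + 2 - 2 * k) * ((-1) ^ k * poch (-(n : ℝ) - 3 / 2 + k) k) := by
    rw [show n + 2 - k = n + 2 - 2 * k + k by omega, poch_add,
      poch_reflect (1 / 2 + ((n + 2 - 2 * k : ℕ) : ℝ)), Nat.cast_sub (by omega)]
    congr 3
    push_cast
    ring
  have n0 := poch_half_ne_zero (n + 2 - k)
  have n1 := poch_half_ne_zero (n + 2 - 2 * k)
  rw [e1] at n0
  have n2 := right_ne_zero_of_mul (right_ne_zero_of_mul n0)
  have f0 := Nat.factorial_ne_zero k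
  have f1 := Nat.factorial_ne_zero (n + 1 + m - 2 * k)
  rw [wConst, if_pos (by omega), e1, show n + m + 1 = n + 1 + m by ring]
  have : ((-1 : ℝ) ^ k) * (-1) ^ k = 1 := by rw [← mul_pow]; simp
  have hs : ((-1 : ℝ) ^ k) ≠ 0 := by simp
  generalize (-1 : ℝ) ^ k = s at *
  generalize poch (-(n : ℝ) - 3 / 2 + k) k = p at *
  field_simp
  linear_combination -this

/-- A half-integer is never $0$, so all Pochhammer symbols based at $\alpha=-n-\tfrac32$ are
invertible. -/
theorem natCast_add_half_ne (n i : ℕ) : -(n : ℝ) - 3 / 2 + i ≠ 0 := by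
  intro h
  have : (2 * i : ℝ) = 2 * n + 3 := by linear_combination 2 * h
  have : 2 * i = 2 * n + 3 := by exact_mod_cast this
  omega

/-- The composition of the conversions from `μ̃` to `μ` and from `μ` to `0`. -/
theorem sum_ordinaryHypergeometric_mul_wConst_mul_uCoeff {n m K : ℕ} (h : 2 * K + m ≤ n + 1)
    (t : ℝ) :
    ∑ k ∈ Finset.range (K + 1), ₂F₁ (-(k : ℝ)) (-(n : ℝ) + k - 3 / 2) (-(n : ℝ) - 1 / 2) t *
        wConst n m k * uCoeff (n + 1 - 2 * k) m (K - k) = uCoeff (n + 1) m K * t ^ K := by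
  have key := sum_ordinaryHypergeometric_div_poch (-(n : ℝ) - 3 / 2)
    (natCast_add_half_ne n) K t
  have hp : ∀ l k : ℕ, poch (-(n : ℝ) - 3 / 2 + l) k ≠ 0 := fun l k => poch_ne_zero fun i _ => by
    have := natCast_add_half_ne n (l + i)
    push_cast at this
    rwa [add_assoc]
  have e : uCoeff (n + 1) m K * t ^ K =
      ((n + 1 + m).factorial : ℝ) / ((n + 1 + m - 2 * K).factorial : ℝ) / 4 ^ K *
        (t ^ K / (poch (-(n : ℝ) - 3 / 2 + 1) K * (K.factorial : ℝ))) := by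
    rw [uCoeff_eq h]
    push_cast
    rw [show (1 / 2 - ((n : ℝ) + 1)) = -n - 3 / 2 + 1 by ring]
    have := hp 1 K
    push_cast at this
    field_simp
  rw [e, ← key, Finset.mul_sum]
  refine Finset.sum_congr rfl fun k hk => ?_
  have hk : k ≤ K := Nat.lt_succ_iff.1 (Finset.mem_range.1 hk)
  rw [show -(n : ℝ) + k - 3 / 2 = -n - 3 / 2 + k by ring,
    show -(n : ℝ) - 1 / 2 = -n - 3 / 2 + 1 by ring, mul_assoc,
    mul_left_comm (_ / _ / _)]
  congr 1
  have e3 : (4 : ℝ) ^ K = 4 ^ k * 4 ^ (K - k) := by rw [← pow_add]; congr 1; omega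
  -- The first block comes from `wConst`, the last from `uCoeff` in degree $n+1-2k$; the middle
  -- factor cancels the numerator $\alpha+2k$.
  have e2 : poch (-(n : ℝ) - 3 / 2 + k) (K + 1) = poch (-(n : ℝ) - 3 / 2 + k) k *
      ((-(n : ℝ) - 3 / 2 + 2 * k) * poch (-(n : ℝ) - 3 / 2 + 2 * k + 1) (K - k)) := by
    rw [show K + 1 = k + (1 + (K - k)) by omega, poch_add, poch_add _ 1, poch_one]
    push_cast
    ring_nf
  rw [wConst_eq (by omega), uCoeff_eq (by omega), e2, e3, Nat.cast_sub (by omega),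
    show n + 1 - 2 * k + m = n + 1 + m - 2 * k by omega,
    show n + 1 + m - 2 * k - 2 * (K - k) = n + 1 + m - 2 * K by omega]
  rw [show 1 / 2 - (((n + 1 : ℕ) : ℝ) - ((2 * k : ℕ) : ℝ)) = -(n : ℝ) - 3 / 2 + 2 * k + 1 by
    push_cast; ring]
  have n0 := hp k k
  have n1 := hp (2 * k + 1) (K - k)
  have n2 := natCast_add_half_ne n (2 * k)
  push_cast at n1 n2
  rw [← add_assoc] at n1
  have f0 := Nat.factorial_ne_zero k
  have f1 := Nat.factorial_ne_zero (K - k)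
  have f2 := Nat.factorial_ne_zero (n + 1 + m - 2 * k)
  have f3 := Nat.factorial_ne_zero (n + 1 + m - 2 * K)
  generalize -(n : ℝ) - 3 / 2 + 2 * k = γ at *
  field_simp

/-! ### Solid harmonics as polynomials -/

/-- The linear map `x ↦ x₁ + i x₂`. -/
def planar : E3 →L[ℝ] ℂ :=
  (EuclideanSpace.proj (1 : Fin 3)).smulRight (1 : ℂ) +
    (EuclideanSpace.proj (2 : Fin 3)).smulRight Complex.I

theorem planar_apply (x : E3) : planar x = ⟨x 1, x 2⟩ := by
  apply Complex.ext <;> simp [planar]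

/-- The real part for the sign `+` and the imaginary part for the sign `-`. -/
def signPart (ε : ℤˣ) : ℂ →L[ℝ] ℝ := if ε = 1 then Complex.reCLM else Complex.imCLM

theorem signPart_real_mul (ε : ℤˣ) (a : ℝ) (z : ℂ) : signPart ε (a * z) = a * signPart ε z := by
  unfold signPart
  split_ifs <;> simp

/-- De Moivre's formula. The radius $\rho$ may be negative, as happens for general complex
spheroidal coordinates. -/
theorem signPart_pow_eq (ε : ℤˣ) (m : ℕ) (ρ φ : ℝ) {z : ℂ}
    (hz : z = ρ * (Real.cos φ + Real.sin φ * Complex.I)) :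
    signPart ε (z ^ m) = ρ ^ m * ang ε m φ := by
  have h : z ^ m = (ρ ^ m : ℝ) * (Real.cos (m * φ) + Real.sin (m * φ) * Complex.I) := by
    rw [hz, mul_pow]
    push_cast
    rw [Complex.cos_add_sin_mul_I_pow]
  rw [h, signPart_real_mul]
  congr 1
  unfold signPart ang
  split_ifs
  · simp only [Complex.reCLM_apply, Complex.add_re, Complex.re_ofReal_mul, Complex.I_re, mul_zero,
      Complex.ofReal_re, add_zero]
  · simp only [Complex.imCLM_apply, Complex.add_im, Complex.im_ofReal_mul, Complex.I_im, mul_one,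
      Complex.ofReal_im, zero_add]

/-- Weighted homogeneity: $x$ has weight $1$ and $y$ has weight $2$. -/
theorem pow_mul_solidPoly {A : Type*} [CommRing A] [Algebra ℝ A] {n m : ℕ} (c x y : A) :
    c ^ (n - m) * solidPoly n m x y = solidPoly n m (c * x) (c ^ 2 * y) := by
  unfold solidPoly
  split_ifs
  · rw [Finset.mul_sum]
    refine Finset.sum_congr rfl fun i hi => ?_
    have := Finset.mem_range.1 hi
    rw [mul_smul_comm, mul_pow, mul_pow, ← pow_mul]
    conv_lhs => rw [show n - m = (n - m - 2 * i) + 2 * i by omega, pow_add]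
    rw [show n - m - 2 * i + 2 * i - 2 * i = n - m - 2 * i by omega]
    congr 1
    ring
  · simp

theorem solidPoly_one_right {A : Type*} [CommRing A] [Algebra ℝ A] (n m : ℕ) (x : A) :
    solidPoly n m x 1 = Polynomial.aeval x (legendreDeriv n m) := by
  unfold solidPoly
  split_ifs with h
  · rw [legendreDeriv_eq_sum h, map_sum]
    exact Finset.sum_congr rfl fun i _ => by simp [Algebra.smul_def]
  · rw [legendreDeriv_eq_zero (by omega), map_zero]

theorem norm_sq_eq (x : E3) : ‖x‖ ^ 2 = x 0 ^ 2 + x 1 ^ 2 + x 2 ^ 2 := by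
  rw [EuclideanSpace.real_norm_sq_eq, Fin.sum_univ_three]

theorem solid_zero_param (n m : ℕ) (ε : ℤˣ) (x : E3) :
    solid n m ε 0 x = (-1) ^ m * signPart ε (planar x ^ m) * solidPoly n m (x 0) (‖x‖ ^ 2) := by
  have hz : planar x = ‖planar x‖ * (Real.cos (Complex.arg ⟨x 1, x 2⟩) +
      Real.sin (Complex.arg ⟨x 1, x 2⟩) * Complex.I) := by
    rw [← planar_apply]
    push_cast
    exact (Complex.norm_mul_cos_add_sin_mul_I _).symm
  rw [solid, dif_pos rfl, signPart_pow_eq ε m _ _ hz, assocLegendre]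
  rcases lt_or_ge n m with h | h
  · rw [legendreDeriv_eq_zero h, solidPoly, if_neg (by omega)]
    simp
  have hn : ‖planar x‖ ^ 2 = x 1 ^ 2 + x 2 ^ 2 := by
    rw [planar_apply, Complex.sq_norm, Complex.normSq_mk]
    ring
  rcases eq_or_ne x 0 with rfl | hx
  · simp only [norm_zero, map_zero, PiLp.zero_apply, div_zero, ne_eq, OfNat.ofNat_ne_zero,
      not_false_eq_true, zero_pow, sub_zero, Real.sqrt_one, one_pow]
    -- At the origin $x_0/|x|$ has the default value $0$. For $m=0$ homogeneity with scale $0$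
    -- settles the claim; for $m>0$ both sides vanish.
    rcases Nat.eq_zero_or_pos m with rfl | hm
    · have h0 := pow_mul_solidPoly (n := n) (m := 0) (0 : ℝ) 0 1
      rw [solidPoly_one_right, Polynomial.coe_aeval_eq_eval, Nat.sub_zero, zero_mul,
        zero_pow two_ne_zero, zero_mul] at h0
      rw [← h0]
      ring
    · rw [zero_pow (by omega : n ≠ 0), zero_pow (by omega : m ≠ 0)]
      ring
  · have hr : ‖x‖ ≠ 0 := norm_ne_zero_iff.2 hx
    have h0 := pow_mul_solidPoly (n := n) (m := m) ‖x‖ (x 0 / ‖x‖) 1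
    rw [solidPoly_one_right, Polynomial.coe_aeval_eq_eval, mul_one, mul_div_cancel₀ _ hr] at h0
    have hs : ‖x‖ * Real.sqrt (1 - (x 0 / ‖x‖) ^ 2) = ‖planar x‖ := by
      rw [← Real.sqrt_sq (norm_nonneg (planar x)), hn, ← Real.sqrt_sq (norm_nonneg x),
        ← Real.sqrt_mul (sq_nonneg _), Real.sqrt_sq (norm_nonneg x)]
      congr 1
      field_simp
      rw [norm_sq_eq]
      ring
    rw [← h0, ← hs, mul_pow]
    conv_lhs => rw [show n = m + (n - m) by omega, pow_add]
    rw [show m + (n - m) = n by omega]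
    ring

theorem params_sq {μ : ℂ} (h : μ ∈ params) : μ ^ 2 = ((μ ^ 2).re : ℝ) := by
  apply Complex.ext
  · simp
  · rcases h with h | h <;> simp [pow_two, h.1]

theorem params_pow_re {μ : ℂ} (h : μ ∈ params) (k : ℕ) : (μ ^ (2 * k)).re = (μ ^ 2).re ^ k := by
  rw [pow_mul, params_sq h, ← Complex.ofReal_pow, Complex.ofReal_re, Complex.ofReal_re]

theorem uCoeff_zero {n m : ℕ} (h : m ≤ n) : uCoeff n m 0 = 1 := by
  rw [uCoeff, if_pos ⟨h, by omega⟩]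
  have := poch_half_ne_zero n
  rw [poch_zero]
  simp only [Nat.sub_zero, pow_zero, Nat.factorial_zero, Nat.cast_one, mul_one, one_mul]
  exact div_self this

theorem solidCoords_eq_sum {n m : ℕ} (h : m ≤ n) (ε : ℤˣ) {μ : ℂ} (hμ : μ ∈ params) {x : E3}
    {u v : ℂ} {φ : ℝ} (hc : IsCoords μ x u v φ) :
    solidCoords n m ε μ u v φ = (((-1) ^ m * signPart ε (planar x ^ m) *
      ∑ k ∈ Finset.range ((n - m) / 2 + 1), uCoeff n m k * (μ ^ 2).re ^ k *
        solidPoly (n - 2 * k) m (x 0) (‖x‖ ^ 2) : ℝ) : ℂ) := by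
  obtain ⟨h0, h1, h2⟩ := hc
  have a1 := Complex.sin_sq_add_cos_sq u
  have a2 := Complex.cosh_sq v
  have a3 : ((Real.sin φ : ℂ)) ^ 2 + (Real.cos φ : ℂ) ^ 2 = 1 := by
    exact_mod_cast Real.sin_sq_add_cos_sq φ
  -- Although $\mu$, $u$, $v$ may be complex, this product is real: it is the signed distance to the
  -- axis.
  have hw : μ * Complex.sin u * Complex.sinh v =
      ((x 1 * Real.cos φ + x 2 * Real.sin φ : ℝ) : ℂ) := by
    push_cast
    rw [h1, h2]
    push_cast at a3 ⊢
    linear_combination (-(μ * Complex.sin u * Complex.sinh v)) * a3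
  rw [hw] at h1 h2
  have hz : planar x = ((x 1 * Real.cos φ + x 2 * Real.sin φ : ℝ) : ℂ) *
      (Real.cos φ + Real.sin φ * Complex.I) := by
    rw [mul_add, ← h1, ← mul_assoc, ← h2, planar_apply]
    apply Complex.ext <;> simp
  have hr : ((‖x‖ ^ 2 : ℝ) : ℂ) =
      μ ^ 2 * (Complex.cos u ^ 2 + Complex.cosh v ^ 2 - 1) := by
    have e : (x 1 : ℂ) ^ 2 + (x 2 : ℂ) ^ 2 = (μ * Complex.sin u * Complex.sinh v) ^ 2 := by
      rw [h1, h2, ← hw]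
      linear_combination (μ * Complex.sin u * Complex.sinh v) ^ 2 * a3
    rw [norm_sq_eq]
    push_cast
    rw [add_assoc, e, h0]
    have s1 : Complex.sin u ^ 2 = 1 - Complex.cos u ^ 2 := by linear_combination a1
    have s2 : Complex.sinh v ^ 2 = Complex.cosh v ^ 2 - 1 := by linear_combination -a2
    linear_combination (μ ^ 2 * Complex.sinh v ^ 2) * s1 + (μ ^ 2 * (1 - Complex.cos u ^ 2)) * s2
  have hp := congrArg (MvPolynomial.aeval ![Complex.cos u, Complex.cosh v])
    (legendreDeriv_mul_legendreDeriv h)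
  rw [map_smul, map_mul, ← Polynomial.aeval_algHom_apply, ← Polynomial.aeval_algHom_apply,
    map_sum] at hp
  simp only [map_smul, map_solidPoly, map_mul, map_sub, map_add, map_pow, map_one,
    MvPolynomial.aeval_X, Matrix.cons_val_zero, Matrix.cons_val_one] at hp
  have key : (((n - m).factorial : ℝ) / (2 ^ n * poch (1 / 2) n) : ℝ) * μ ^ (n - m) *
      (Polynomial.aeval (Complex.cos u) (legendreDeriv n m) *
        Polynomial.aeval (Complex.cosh v) (legendreDeriv n m)) =
      ((∑ k ∈ Finset.range ((n - m) / 2 + 1), uCoeff n m k * (μ ^ 2).re ^ k *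
        solidPoly (n - 2 * k) m (x 0) (‖x‖ ^ 2) : ℝ) : ℂ) := by
    rw [mul_assoc, mul_left_comm, ← Complex.real_smul, hp, Finset.mul_sum, Complex.ofReal_sum]
    refine Finset.sum_congr rfl fun k hk => ?_
    have hk : 2 * k + m ≤ n := by
      have := Finset.mem_range.1 hk
      omega
    have e := map_solidPoly Complex.ofRealAm (n - 2 * k) m (x 0) (‖x‖ ^ 2)
    simp only [Complex.ofRealAm_coe] at e
    -- Homogeneity absorbs $\mu^{n-2k-m}$ into the zonal polynomial; the leftover $\mu^{2k}$ is
    -- real.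
    rw [Complex.ofReal_mul, e, hr, h0, mul_assoc μ, ← pow_mul_solidPoly, Complex.ofReal_mul,
      Complex.ofReal_pow, ← params_sq hμ, ← pow_mul, Complex.real_smul,
      show n - m = 2 * k + (n - 2 * k - m) by omega, pow_add]
    ring
  rw [Complex.ofReal_mul, ← key, signPart_pow_eq ε m _ _ hz]
  push_cast at hw ⊢
  rw [← hw, solidCoords, assocLegendreCos, assocLegendreCosh, mul_pow, mul_pow,
    show μ ^ n = μ ^ m * μ ^ (n - m) by rw [← pow_add, Nat.add_sub_cancel' h]]
  push_cast
  ring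

/-- One polynomial expression for all parameters: at $\mu=0$ only the term $k=0$ survives. -/
theorem solid_eq_solidPoly_sum {n m : ℕ} (h : m ≤ n) (ε : ℤˣ) {μ : ℂ} (hμ : μ ∈ params) (x : E3) :
    solid n m ε μ x = (-1) ^ m * signPart ε (planar x ^ m) *
      ∑ k ∈ Finset.range ((n - m) / 2 + 1), uCoeff n m k * (μ ^ 2).re ^ k *
        solidPoly (n - 2 * k) m (x 0) (‖x‖ ^ 2) := by
  rcases eq_or_ne μ 0 with rfl | h0
  · rw [solid_zero_param, Finset.sum_range_succ', Finset.sum_eq_zero]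
    · simp [uCoeff_zero h]
    · intro k _
      simp
  · rw [solid, dif_neg h0, solidCoords_eq_sum h ε hμ (exists_coords h0 x).choose_spec,
      Complex.ofReal_re]

/-! ### Conversion of harmonics and of their derivatives -/

/-- The conversion of spheroidal into spherical harmonics. -/
theorem solid_eq_sum_solid_zero {n m : ℕ} (h : m ≤ n) (ε : ℤˣ) {μ : ℂ} (hμ : μ ∈ params)
    (x : E3) :
    solid n m ε μ x = ∑ k ∈ Finset.range ((n - m) / 2 + 1),
      uCoeff n m k * (μ ^ 2).re ^ k * solid (n - 2 * k) m ε 0 x := by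
  rw [solid_eq_solidPoly_sum h ε hμ, Finset.mul_sum]
  refine Finset.sum_congr rfl fun k _ => ?_
  rw [solid_zero_param]
  ring

/-- The conversion among spheroidal harmonics. -/
theorem solid_eq_sum_solid {n m : ℕ} (h : m ≤ n + 1) (ε : ℤˣ) {μ μt : ℂ} (hμ : μ ∈ params)
    (hμt : μt ∈ params) (x : E3) :
    solid (n + 1) m ε μt x = ∑ k ∈ Finset.range ((n + 1 - m) / 2 + 1),
      w n m k μt μ * solid (n + 1 - 2 * k) m ε μ x := by
  rw [solid_eq_sum_solid_zero h ε hμt]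
  rcases eq_or_ne μ 0 with rfl | h0
  · refine Finset.sum_congr rfl fun k _ => ?_
    rw [w, if_pos rfl, params_pow_re hμt]
  have hs : (μ ^ 2).re ≠ 0 := by
    intro e
    have := params_sq hμ
    rw [e, Complex.ofReal_zero] at this
    exact h0 (pow_eq_zero_iff two_ne_zero |>.1 this)
  have ht : ((μt / μ) ^ 2).re = (μt ^ 2).re / (μ ^ 2).re := by
    rw [div_pow, params_sq hμt, params_sq hμ, ← Complex.ofReal_div, Complex.ofReal_re,
      Complex.ofReal_re, Complex.ofReal_re]
  set D := (n + 1 - m) / 2 with hD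
  -- Each $U[\mu]$ is expanded in spherical harmonics, indexed by the total shift $K$, so that after
  -- the exchange of sums the coefficient of each one is the hypergeometric sum.
  have inner : ∀ k ∈ Finset.Ico 0 (D + 1), w n m k μt μ * solid (n + 1 - 2 * k) m ε μ x =
      ∑ K ∈ Finset.Ico k (D + 1), (₂F₁ (-(k : ℝ)) (-(n : ℝ) + k - 3 / 2) (-(n : ℝ) - 1 / 2)
        (((μt / μ) ^ 2).re) * wConst n m k * uCoeff (n + 1 - 2 * k) m (K - k)) *
        ((μ ^ 2).re ^ K * solid (n + 1 - 2 * K) m ε 0 x) := by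
    intro k hk
    have hk : k ≤ D := by
      have := (Finset.mem_Ico.1 hk).2
      omega
    rw [solid_eq_sum_solid_zero (by omega) ε hμ, Finset.mul_sum, Finset.sum_Ico_eq_sum_range,
      show D + 1 - k = (n + 1 - 2 * k - m) / 2 + 1 by omega]
    refine Finset.sum_congr rfl fun j _ => ?_
    rw [w, if_neg h0, params_pow_re hμ, Nat.add_sub_cancel_left,
      show n + 1 - 2 * (k + j) = n + 1 - 2 * k - 2 * j by omega, pow_add]
    ring
  rw [Finset.range_eq_Ico, Finset.sum_congr rfl inner, Finset.sum_Ico_Ico_comm]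
  refine Finset.sum_congr rfl fun K hK => ?_
  have hK : K ≤ D := by
    have := (Finset.mem_Ico.1 hK).2
    omega
  rw [← Finset.sum_mul, ← Finset.range_eq_Ico,
    sum_ordinaryHypergeometric_mul_wConst_mul_uCoeff (by omega), ht, div_pow]
  field_simp

theorem solid_eq_zero {n m : ℕ} (h : n < m) (ε : ℤˣ) (μ : ℂ) (x : E3) : solid n m ε μ x = 0 := by
  unfold solid
  split_ifs <;>
    simp [assocLegendre, solidCoords, assocLegendreCos, legendreDeriv_eq_zero h]

theorem differentiable_solid (n m : ℕ) (ε : ℤˣ) {μ : ℂ} (hμ : μ ∈ params) :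
    Differentiable ℝ (solid n m ε μ) := by
  rcases lt_or_ge n m with h | h
  · rw [show solid n m ε μ = fun _ => 0 from funext fun x => solid_eq_zero h ε μ x]
    exact differentiable_const _
  · rw [show solid n m ε μ = _ from funext fun x => solid_eq_solidPoly_sum h ε hμ x]
    have h1 : Differentiable ℝ fun x : E3 => signPart ε (planar x ^ m) :=
      (signPart ε).differentiable.comp (planar.differentiable.pow m)
    have h2 : Differentiable ℝ fun x : E3 => x 0 :=
      (EuclideanSpace.proj (0 : Fin 3) : E3 →L[ℝ] ℝ).differentiable
    have h3 : Differentiable ℝ fun x : E3 => ‖x‖ ^ 2 := differentiable_id.norm_sq ℝ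
    refine (h1.const_mul _).mul (Differentiable.fun_sum fun k _ => Differentiable.const_mul ?_ _)
    unfold solidPoly
    split_ifs
    · exact Differentiable.fun_sum fun i _ =>
        ((h2.fun_pow _).fun_mul (h3.fun_pow _)).fun_const_smul _
    · exact differentiable_const _

theorem pderiv_solid_eq_sum {n m : ℕ} (h : m ≤ n + 1) (ε : ℤˣ) {μ μt : ℂ} (hμ : μ ∈ params)
    (hμt : μt ∈ params) (i : Fin 3) (x : E3) :
    pderiv i (solid (n + 1) m ε μt) x = ∑ k ∈ Finset.range ((n + 1 - m) / 2 + 1),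
      w n m k μt μ * pderiv i (solid (n + 1 - 2 * k) m ε μ) x := by
  unfold pderiv
  rw [show solid (n + 1) m ε μt = _ from funext fun x => solid_eq_sum_solid h ε hμ hμt x,
    fderiv_fun_sum fun k _ => ((differentiable_solid _ m ε hμ).const_mul _).differentiableAt,
    sum_apply]
  refine Finset.sum_congr rfl fun k _ => ?_
  rw [fderiv_const_mul (differentiable_solid _ m ε hμ).differentiableAt]
  simp

/-- The derivatives across the axis of the harmonics `U_{m,m}` and `U_{m+1,m}`. -/
theorem pderiv_solid_of_le {n m : ℕ} (h : n ≤ m + 1) (ε : ℤˣ) {μ : ℂ} (hμ : μ ∈ params)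
    {i : Fin 3} (hi : i ≠ 0) (x : E3) :
    pderiv i (solid n m ε μ) x = (-1) ^ m * solidPoly n m (x 0) 0 *
      signPart ε (m * planar x ^ (m - 1) * planar (EuclideanSpace.single i 1)) := by
  rcases lt_or_ge n m with h' | h'
  · rw [show solid n m ε μ = fun _ => 0 from funext fun x => solid_eq_zero h' ε μ x]
    simp [pderiv, solidPoly, h']
  have h1 : HasFDerivAt (fun x : E3 => signPart ε (planar x ^ m)) _ x :=
    (signPart ε).hasFDerivAt.comp x (planar.hasFDerivAt.pow m)
  have h2 : HasFDerivAt (fun x : E3 => (x 0) ^ (n - m)) _ x :=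
    (EuclideanSpace.proj (0 : Fin 3) : E3 →L[ℝ] ℝ).hasFDerivAt.pow (n - m)
  -- Since $n-m\le1$, a single term remains; it is free of $\mu$, and $|x|^2$ does not occur in it.
  have e : solid n m ε μ = fun x => ((-1) ^ m * legendreCoeff n m 0) *
      (signPart ε (planar x ^ m) * (x 0) ^ (n - m)) := by
    funext x
    rw [solid_eq_solidPoly_sum h' ε hμ, show (n - m) / 2 + 1 = 1 by omega, Finset.sum_range_one,
      uCoeff_zero h', solidPoly, if_pos (by omega), show (n - 2 * 0 - m) / 2 + 1 = 1 by omega,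
      Finset.sum_range_one]
    simp
    ring
  have h3 := ((h1.mul h2).const_mul ((-1) ^ m * legendreCoeff n m 0)).fderiv
  rw [pderiv, e]
  erw [h3]
  rw [solidPoly, if_pos h', show (n - m) / 2 + 1 = 1 by omega, Finset.sum_range_one]
  simp [Ne.symm hi]
  ring

/-! ### Ambigenics -/

/-- The quaternion `a e₁ + b e₂`. -/
def planeVec (a b : ℝ) : ℍ[ℝ] := ⟨0, a, b, 0⟩

@[simp] theorem planeVec_re (a b : ℝ) : (planeVec a b).re = 0 := rfl
@[simp] theorem planeVec_imI (a b : ℝ) : (planeVec a b).imI = a := rfl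
@[simp] theorem planeVec_imJ (a b : ℝ) : (planeVec a b).imJ = b := rfl
@[simp] theorem planeVec_imK (a b : ℝ) : (planeVec a b).imK = 0 := rfl

@[simp] theorem e₃_re : e₃.re = 0 := rfl
@[simp] theorem e₃_imI : e₃.imI = 0 := rfl
@[simp] theorem e₃_imJ : e₃.imJ = 0 := rfl
@[simp] theorem e₃_imK : e₃.imK = 1 := rfl

theorem planeVec_mul_e₃ (a b : ℝ) : planeVec a b * e₃ = planeVec b (-a) := by
  ext <;> simp

theorem smul_planeVec (c a b : ℝ) : c • planeVec a b = planeVec (c * a) (c * b) := by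
  ext <;> simp

theorem neg_planeVec (a b : ℝ) : -planeVec a b = planeVec (-a) (-b) := by
  ext <;> simp

theorem sum_planeVec {ι : Type*} (s : Finset ι) (a b : ι → ℝ) :
    ∑ i ∈ s, planeVec (a i) (b i) = planeVec (∑ i ∈ s, a i) (∑ i ∈ s, b i) := by
  have e : ∀ a b : ℝ, planeVec a b = a • planeVec 1 0 + b • planeVec 0 1 := by
    intro a b
    ext <;> simp
  rw [e, Finset.sum_congr rfl fun i _ => e (a i) (b i), Finset.sum_add_distrib, Finset.sum_smul,
    Finset.sum_smul]

/-- The quaternion `-2 (e₁ ∂₁ + e₂ ∂₂) f`. -/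
def transverseGradient (f : E3 → ℝ) (x : E3) : ℍ[ℝ] :=
  planeVec (-2 * pderiv 1 f x) (-2 * pderiv 2 f x)

theorem ambi_eq_transverseGradient (n m : ℕ) (ε : ℤˣ) (μ : ℂ) (x : E3) :
    ambi n m ε μ x = transverseGradient (solid (n + 1) m ε μ) x := by
  have e : (monogenic n m ε μ x).im = planeVec (-pderiv 1 (solid (n + 1) m ε μ) x)
      (-pderiv 2 (solid (n + 1) m ε μ) x) := rfl
  rw [ambi, e, smul_planeVec, transverseGradient]
  ring_nf

/-- Stated in the degrees $n+1-2k$ of the harmonics, because $n-2k$ would be truncated when $m=0$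
and $2k=n+1$. -/
theorem transverseGradient_solid_eq_sum {n m : ℕ} (h : m ≤ n + 1) (ε : ℤˣ) {μ μt : ℂ}
    (hμ : μ ∈ params) (hμt : μt ∈ params) (x : E3) :
    transverseGradient (solid (n + 1) m ε μt) x = ∑ k ∈ Finset.range ((n + 1 - m) / 2 + 1),
      w n m k μt μ • transverseGradient (solid (n + 1 - 2 * k) m ε μ) x := by
  simp only [transverseGradient, smul_planeVec, mul_left_comm (w n m _ μt μ)]
  rw [sum_planeVec, ← Finset.mul_sum, ← Finset.mul_sum, ← pderiv_solid_eq_sum h ε hμ hμt,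
    ← pderiv_solid_eq_sum h ε hμ hμt]

/-- The conversion among ambigenics. -/
theorem ambi_eq_sum {n m : ℕ} (hm : 1 ≤ m) (h : m ≤ n + 1) (ε : ℤˣ) {μ μt : ℂ}
    (hμ : μ ∈ params) (hμt : μt ∈ params) (x : E3) :
    ambi n m ε μt x = ∑ k ∈ Finset.range ((n + 1 - m) / 2 + 1),
      w n m k μt μ • ambi (n - 2 * k) m ε μ x := by
  rw [ambi_eq_transverseGradient, transverseGradient_solid_eq_sum h ε hμ hμt]
  refine Finset.sum_congr rfl fun k hk => ?_
  -- Here $m\ge1$ forces $2k\le n$, so $n-2k$ is not truncated.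
  have := Finset.mem_range.1 hk
  rw [ambi_eq_transverseGradient, show n - 2 * k + 1 = n + 1 - 2 * k by omega]

theorem transverseGradient_solid_zero {n : ℕ} (h : n ≤ 1) (ε : ℤˣ) {μ : ℂ} (hμ : μ ∈ params)
    (x : E3) : transverseGradient (solid n 0 ε μ) x = 0 := by
  ext <;> simp [transverseGradient, pderiv_solid_of_le (n := n) (m := 0) h ε hμ]

/-- The conversion among ambigenics with axial symmetry. -/
theorem ambi_zero_eq_sum {n : ℕ} (hn : 1 ≤ n) (ε : ℤˣ) {μ μt : ℂ}
    (hμ : μ ∈ params) (hμt : μt ∈ params) (x : E3) :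
    ambi n 0 ε μt x = ∑ k ∈ Finset.range ((n - 1) / 2 + 1),
      w n 0 k μt μ • ambi (n - 2 * k) 0 ε μ x := by
  rw [ambi_eq_transverseGradient, transverseGradient_solid_eq_sum (by omega) ε hμ hμt]
  symm
  refine Finset.sum_subset_zero_on_sdiff (fun k hk => ?_) (fun k hk => ?_) (fun k hk => ?_)
  · simp only [Finset.mem_range] at hk ⊢
    omega
  · simp only [Finset.mem_sdiff, Finset.mem_range, not_lt] at hk
    -- The surplus terms involve $U_{0,0}$ or $U_{1,0}$, which depend on $x_0$ alone.
    rw [transverseGradient_solid_zero (by omega) ε hμ, smul_zero]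
  · have := Finset.mem_range.1 hk
    rw [ambi_eq_transverseGradient, show n - 2 * k + 1 = n + 1 - 2 * k by omega]

/-! ### Contragenics of low degree and the axial coefficients -/

/-- The Cauchy-Riemann equations for `U_{m,m}` and `U_{m+1,m}`. -/
theorem ambi_mul_e₃_of_le {n m : ℕ} (h : n ≤ m) (ε : ℤˣ) {μ : ℂ} (hμ : μ ∈ params) (x : E3) :
    (((ε : ℤ) : ℝ)) • (ambi n m ε μ x * e₃) = -ambi n m (-ε) μ x := by
  have p1 : planar (EuclideanSpace.single 1 1) = 1 := by
    rw [planar_apply]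
    apply Complex.ext <;> simp
  have p2 : planar (EuclideanSpace.single 2 1) = Complex.I := by
    rw [planar_apply]
    apply Complex.ext <;> simp
  have hne : ¬ ((-1 : ℤˣ) = 1) := by decide
  rw [ambi_eq_transverseGradient, ambi_eq_transverseGradient, transverseGradient,
    transverseGradient]
  simp only [pderiv_solid_of_le (n := n + 1) (m := m) (by omega) _ hμ one_ne_zero,
    pderiv_solid_of_le (n := n + 1) (m := m) (by omega) _ hμ (show (2 : Fin 3) ≠ 0 by decide),
    p1, p2, planeVec_mul_e₃, smul_planeVec, neg_planeVec]
  -- Up to the common factor $C$, the derivatives across the axis are the real or imaginary parts of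
  -- $W$ and $iW$; changing the sign swaps the two parts.
  generalize (m : ℂ) * planar x ^ (m - 1) = W
  generalize (-1) ^ m * solidPoly (n + 1) m (x 0) 0 = C
  rcases Int.units_eq_one_or ε with rfl | rfl <;>
  · congr 1 <;> simp [signPart, hne]

/-- The contragenics of order `m ≥ 1` vanish in degrees up to `m`. -/
theorem contra_eq_zero (κ : ℝ) {n m : ℕ} (hm : 1 ≤ m) (h : n ≤ m) (ε : ℤˣ) {μ : ℂ}
    (hμ : μ ∈ params) (x : E3) : contra κ n m ε μ x = 0 := by
  have h0 : normRatio κ n m μ = 0 := by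
    rw [normRatio, if_neg (by omega), if_neg (by omega)]
  rw [contra, if_neg (by omega), h0, zero_add, mul_one, ambi_mul_e₃_of_le h ε hμ]
  module

theorem normRatio_nonneg {κ : ℝ} (hκ : 0 ≤ κ) (n m : ℕ) (μ : ℂ) : 0 ≤ normRatio κ n m μ := by
  unfold normRatio
  split_ifs <;> positivity

/-- Only the quotient $(n+m+1)!/(n+m+1-2k)!$ depends on $m$, both for $\mu=0$ and for $\mu\ne0$; its
values at $m=0$ and $m=1$ differ by the stated factor. -/
theorem w_zero_eq {n k : ℕ} (h : 2 * k ≤ n + 1) (μt μ : ℂ) :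
    w n 0 k μt μ = ((n : ℝ) - 2 * k + 2) / (n + 2) * w n 1 k μt μ := by
  have key : ∀ m : ℕ, 2 * k + m ≤ n + 2 → wConst n m k =
      ((n + m + 1).factorial : ℝ) / ((n + m + 1 - 2 * k).factorial : ℝ) *
        (poch (1 / 2) (n + 2 - 2 * k) / (4 ^ k * (k.factorial : ℝ) * poch (1 / 2) (n + 2 - k))) := by
    intro m hm
    rw [wConst, if_pos hm]
    field_simp
  have key' : ∀ m : ℕ, m ≤ 1 → uCoeff (n + 1) m k =
      ((n + m + 1).factorial : ℝ) / ((n + m + 1 - 2 * k).factorial : ℝ) *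
        (poch (1 / 2) (n + 1 - k) / ((-4) ^ k * poch (1 / 2) (n + 1) * (k.factorial : ℝ))) := by
    intro m hm
    have := poch_natCast_add_one (n + m + 1 - 2 * k) (2 * k)
    rw [Nat.sub_add_cancel (by omega), Nat.cast_sub (by omega)] at this
    rw [uCoeff, if_pos ⟨by omega, h⟩, ← this]
    have := Nat.factorial_ne_zero (n + m + 1 - 2 * k)
    push_cast
    rw [show (n : ℝ) + 1 + m - 2 * k + 1 = n + m + 1 - 2 * k + 1 by ring]
    field_simp
  have ratio : ((n + 0 + 1).factorial : ℝ) / ((n + 0 + 1 - 2 * k).factorial : ℝ) =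
      ((n : ℝ) - 2 * k + 2) / (n + 2) *
        (((n + 1 + 1).factorial : ℝ) / ((n + 1 + 1 - 2 * k).factorial : ℝ)) := by
    obtain ⟨d, hd⟩ := Nat.exists_eq_add_of_le h
    have hd' : (n : ℝ) = 2 * k + d - 1 := by
      have : ((n + 1 : ℕ) : ℝ) = ((2 * k + d : ℕ) : ℝ) := by rw [hd]
      push_cast at this
      linarith
    rw [show n + 0 + 1 - 2 * k = d by omega, show n + 1 + 1 - 2 * k = d + 1 by omega,
      Nat.factorial_succ (n + 1), Nat.factorial_succ d, add_zero]
    have := Nat.factorial_ne_zero d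
    have e : (n : ℝ) + 2 ≠ 0 := by positivity
    have e' : (n : ℝ) - 2 * k + 2 = d + 1 := by
      rw [hd']
      ring
    rw [e']
    push_cast
    field_simp
    ring
  unfold w
  split_ifs
  · rw [key' 0 (by omega), key' 1 (by omega), ratio]
    ring
  · rcases Nat.lt_or_ge (n + 1) (2 * k) with h' | h'
    · omega
    · rw [key 0 (by omega), key 1 (by omega), ratio]
      ring

end Spheroidal

end

/-! ### Expansion of the contragenics -/

theorem mainTheorem3 (κ : ℝ) (hκ : κ = 1 ∨ κ = 2) (μ μt : ℂ)
    (hμ : μ ∈ Spheroidal.params) (hμt : μt ∈ Spheroidal.params) (n : ℕ) (hn : 1 ≤ n) :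
    (∀ x : Spheroidal.E3,
      Spheroidal.contra κ n 0 1 μt x =
        ∑ k ∈ Finset.range ((n - 1) / 2 + 1),
          Spheroidal.zC κ n 0 k μt μ • Spheroidal.contra κ (n - 2 * k) 0 1 μ x) ∧
    (∀ m : ℕ, 1 ≤ m → m ≤ n - 1 → ∀ ε : ℤˣ, ∀ x : Spheroidal.E3,
      Spheroidal.contra κ n m ε μt x =
        ∑ k ∈ Finset.range ((n - m + 1) / 2 + 1),
          (Spheroidal.zC κ n m k μt μ • Spheroidal.contra κ (n - 2 * k) m ε μ x +
            Spheroidal.zA κ n m k μt μ • Spheroidal.ambi (n - 2 * k) m (-ε) μ x)) := by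
  open Spheroidal in
  have hκ0 : 0 ≤ κ := by rcases hκ with rfl | rfl <;> norm_num
  refine ⟨fun x => ?_, fun m hm hmn ε x => ?_⟩
  · rw [contra, if_pos rfl, ambi_zero_eq_sum hn 1 hμ hμt, Finset.sum_mul, ← Finset.sum_neg_distrib]
    refine Finset.sum_congr rfl fun k hk => ?_
    have := Finset.mem_range.1 hk
    rw [contra, if_pos rfl, zC, if_pos rfl, w_zero_eq (by omega), smul_neg, smul_mul_assoc]
  · rw [contra, if_neg (by omega), ambi_eq_sum hm (by omega) ε hμ hμt,
      ambi_eq_sum hm (by omega) (-ε) hμ hμt, Finset.sum_mul, Finset.smul_sum, Finset.smul_sum,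
      ← Finset.sum_sub_distrib, Finset.smul_sum, show n + 1 - m = n - m + 1 by omega]
    refine Finset.sum_congr rfl fun k hk => ?_
    have hk : 2 * k + m ≤ n + 1 := by
      have := Finset.mem_range.1 hk
      omega
    have hν : normRatio κ (n - 2 * k) m μ + 1 ≠ 0 := by
      have := normRatio_nonneg hκ0 (n - 2 * k) m μ
      positivity
    rw [smul_mul_assoc]
    by_cases hkn : 2 * k + m + 1 ≤ n
    · rw [contra, if_neg (by omega), zC, if_neg (by omega), if_pos hkn, zA, if_pos hkn]
      -- Coefficients of $A^\pm e_3$ and $A^\mp$. The second uses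
      -- $(\tilde\nu+1)(\nu_k-1)+2(\tilde\nu-\nu_k)=(\tilde\nu-1)(\nu_k+1)$.
      match_scalars <;> field_simp
      ring
    -- The degree $n-2k$ is $m$ or $m-1$. The contragenic on the right is zero, and on the left the
    -- coefficient of $A^\mp$ becomes $\tfrac12((\tilde\nu-1)+(\tilde\nu+1))w_k=\tilde\nu w_k$.
    · have h0 : normRatio κ (n - 2 * k) m μ = 0 := by
        rw [normRatio, if_neg (by omega), if_neg (by omega)]
      have hA := ambi_mul_e₃_of_le (n := n - 2 * k) (m := m) (by omega) ε hμ x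
      rw [contra_eq_zero κ hm (by omega) ε hμ, zA, if_neg hkn, h0, smul_zero, zero_add, zero_add,
        div_one, smul_comm _ (w n m k μt μ), mul_comm (((ε : ℤ) : ℝ)), mul_smul,
        smul_comm _ (w n m k μt μ), hA]
      module
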